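/- All graphs are finite, simple and undirected. A star is a tree with a vertex adjacent to all of its other vertices (a one-vertex tree is a star), and a leaf is a vertex of degree one. For a tree $T$ that is not a star, let $m_T$ be the maximum cardinality of a set $S$ of leaves of $T$ such that $T-S$ is a tree that is not a star. For a graph $G$ and an integer $k\ge 1$, let $G^k$ be the graph on $V(G)$ in which two distinct vertices are adjacent if and only if their distance in $G$ is at most $k$. For $p\ge 1$, a $p$-labeled packing of $G$ into $G^k$ is a surjective map $f:V(G)\to\{1,\dots,p\}$ for which there is a permutation $\sigma$ of $V(G)$ such that for every edge $xy$ of $G$ the pair $\sigma(x)\sigma(y)$ is not an edge of $G$ and is an edge of $G^k$, and such that $f(\sigma(v))=f(v)$ for every vertex $v$. Let $w^k(G)$ denote the maximum $p$ for which $G$ admits a $p$-labeled packing into $G^k$. Corollary 1.3. Let $T$ be a tree on $n$ vertices that is not a star. Then $$w^6(T)\ \ge\ m_T+\left\lceil\frac{n-m_T}{5}\right\rceil .$$ -/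

import Mathlib

namespace LabeledPacking

variable {V : Type*}

/-- A graph is a star if some vertex `c` is adjacent to all other vertices and there are no
other edges. (The one-vertex graph counts as a star.) -/
def IsStar (G : SimpleGraph V) : Prop :=
  ∃ c : V, G = SimpleGraph.starGraph c

/-- A leaf is a vertex of degree one. -/
def IsLeaf (G : SimpleGraph V) (v : V) : Prop :=
  (G.neighborSet v).ncard = 1

/-- `S` is a set of leaves of `G` such that `G - S` is a tree that is not a star. -/
def IsRemovable (G : SimpleGraph V) (S : Set V) : Prop :=
  (∀ v ∈ S, IsLeaf G v) ∧ (G.induce Sᶜ).IsTree ∧ ¬ IsStar (G.induce Sᶜ)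

/-- `m_T`: the maximum number of leaves that can be removed from `T` in such a way that the
obtained graph is a non-star tree. -/
noncomputable def maxRemovableLeaves (T : SimpleGraph V) : ℕ :=
  sSup {k : ℕ | ∃ S : Set V, S.ncard = k ∧ IsRemovable T S}

/-- The `k`-th power of `G`: distinct vertices at distance at most `k` are adjacent
(vertices in different components are at distance `⊤`). -/
def power (G : SimpleGraph V) (k : ℕ) : SimpleGraph V where
  Adj x y := x ≠ y ∧ G.edist x y ≤ k
  symm := ⟨fun x y h => ⟨h.1.symm, by rw [SimpleGraph.edist_comm]; exact h.2⟩⟩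
  loopless := ⟨fun _ h => h.1 rfl⟩

/-- `σ` is a `2`-placement (embedding) of `G`: no edge of `G` is mapped to an edge of `G`,
that is, the edge sets of `σ(G)` and `G` are disjoint. -/
def IsTwoPlacement (G : SimpleGraph V) (σ : Equiv.Perm V) : Prop :=
  Disjoint (G.map σ).edgeSet G.edgeSet

/-- `f` is a `p`-labeled packing of `G` into `G ^ k`. All `p` labels have to be used. -/
def IsLabeledPowerPacking (G : SimpleGraph V) (k p : ℕ) (f : V → Fin p) : Prop :=
  Function.Surjective f ∧
    ∃ σ : Equiv.Perm V, IsTwoPlacement G σ ∧ G.map σ ≤ power G k ∧ ∀ v, f v = f (σ v)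

/-- `w^k(G)`: the labeled packing `k`-power number, i.e. the maximum `p` for which `G` has a
`p`-labeled packing into `G ^ k`. -/
noncomputable def labeledPowerNumber (G : SimpleGraph V) (k : ℕ) : ℕ :=
  sSup {p : ℕ | ∃ f : V → Fin p, IsLabeledPowerPacking G k p f}

/-- The supremum in `maxRemovableLeaves` is a maximum for every finite non-star tree. -/
theorem isGreatest_maxRemovableLeaves [Finite V] (T : SimpleGraph V) (hT : T.IsTree)
    (hs : ¬ IsStar T) :
    IsGreatest {k : ℕ | ∃ S : Set V, S.ncard = k ∧ IsRemovable T S} (maxRemovableLeaves T) := by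
  have hb : BddAbove {k : ℕ | ∃ S : Set V, S.ncard = k ∧ IsRemovable T S} := by
    refine ⟨Nat.card V, ?_⟩
    rintro k ⟨S, rfl, -⟩
    exact Set.ncard_le_card S
  refine ⟨Nat.sSup_mem ⟨0, ∅, by simp, by simp, ?_⟩ hb, fun k hk => le_csSup hb hk⟩
  rw [Set.compl_empty]
  let e : T.induce Set.univ ≃g T := SimpleGraph.induceUnivIso T
  refine ⟨e.isTree_iff.2 hT, ?_⟩
  rintro ⟨c, hc⟩
  refine hs ⟨c.1, ?_⟩
  ext x y
  have h := congrArg (fun G => G.Adj ⟨x, trivial⟩ ⟨y, trivial⟩) hc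
  simpa [Subtype.ext_iff] using h

/-- The supremum in `labeledPowerNumber` is a maximum as soon as a labeled packing exists. -/
theorem isGreatest_labeledPowerNumber [Finite V] (G : SimpleGraph V) (k p : ℕ)
    (f : V → Fin p) (hf : IsLabeledPowerPacking G k p f) :
    IsGreatest {p : ℕ | ∃ f : V → Fin p, IsLabeledPowerPacking G k p f}
      (labeledPowerNumber G k) := by
  have hb : BddAbove {p : ℕ | ∃ f : V → Fin p, IsLabeledPowerPacking G k p f} := by
    refine ⟨Nat.card V, ?_⟩
    rintro q ⟨g, hg, -⟩
    simpa using Nat.card_le_card_of_surjective g hg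
  exact ⟨Nat.sSup_mem ⟨p, f, hf⟩ hb, fun q hq => le_csSup hb hq⟩

end LabeledPacking

namespace LabeledPacking

variable {V : Type*}

/-! Let `S` be a removable set of leaves of maximum size `m`. It suffices to find a permutation `σ`
fixing every vertex of `S`, moving every other vertex along a cycle of length at most 5, and packing
`T` into its sixth power. Labeling each vertex by its cycle gives `m` labels on `S` and at least `(n
- m) / 5` labels elsewhere.

Leaves in `S` cost nothing. If `u` is such a leaf with neighbour `v`, then `σ v ≠ v` is not adjacent
to `u`, and it lies within `1 + 4` of `u` as soon as `σ` displaces vertices by at most 4. So the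
task is to give every non-star subtree `A` of `T` a short placement (`HasShortPlacement`); this is
`hasShortPlacement_of_nonStarOn`, by strong induction on the size of `A`.

The reductions delete either a pendant path on four vertices, or two pendant paths on at most three
vertices each hanging at the same vertex `x`. The deleted vertices are permuted among themselves by
a fixed pattern that sends the neighbours of `x` to vertices within 2 of `x`. Since `x` itself moves
by at most 4, an edge joining `x` to a deleted vertex acquires length at most `2 + 4 = 6`, and it
cannot land on an edge because `x` moves. `HasShortPlacement.of_model` carries out this gluing, with
the patterns checked by `decide`.

A reduction fails only if it leaves a star. Then either another reduction works, or `A` is one of a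
few explicit trees: a path on 4 to 7 vertices, a spider with legs 2,2,1 or 2,2,2 or 2,1,1, or the
double star with two leaves at each centre. Each has its own pattern. -/

/-- `A` carries a fixed-point-free permutation `σ` (extended by the identity) that moves every vertex
by at most `4`, has only cycles of length at most `5`, and maps the edges of `T` inside `A` to
non-edges of `T` joining vertices at distance at most `6`. -/
def HasShortPlacement (T : SimpleGraph V) (A : Set V) : Prop :=
  ∃ σ : Equiv.Perm V, (∀ v, v ∉ A → σ v = v) ∧
    (∀ v ∈ A, σ v ≠ v ∧ T.edist v (σ v) ≤ 4 ∧ ∃ k : Fin 5, σ^[k + 1] v = v) ∧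
    ∀ u ∈ A, ∀ v ∈ A, T.Adj u v → ¬ T.Adj (σ u) (σ v) ∧ T.edist (σ u) (σ v) ≤ 6

theorem hasShortPlacement_empty (T : SimpleGraph V) : HasShortPlacement T ∅ :=
  ⟨1, by simp, by simp, by simp⟩

/-! ### Finite patterns and the gluing lemma. -/

/-- Adjacency in the forest on `Fin m` with parent function `par`; roots are their own parents. -/
def parentAdj {m : ℕ} (par : Fin m → Fin m) (i j : Fin m) : Bool :=
  !decide (i = j) && (decide (par i = j) || decide (par j = i))

/-- `j` can be reached from `i` in at most `k` steps of `parentAdj par`. -/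
def within {m : ℕ} (par : Fin m → Fin m) : ℕ → Fin m → Fin m → Bool
  | 0, i, j => decide (i = j)
  | k + 1, i, j => decide (i = j) ||
      decide (∃ l : Fin m, parentAdj par i l = true ∧ within par k l j = true)

/-- The combinatorial conditions under which `τ` describes how to extend a short placement by a
copy of the forest `par`; the (at most one) fixed point of `τ` is the vertex of attachment. -/
def IsModel {m : ℕ} (par : Fin m → Fin m) (τ : Equiv.Perm (Fin m)) : Prop :=
  (∀ i j, τ i = i → τ j = j → i = j) ∧
  (∀ i, within par 4 i (τ i) = true) ∧
  (∀ i, ∃ k : Fin 5, τ^[k + 1] i = i) ∧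
  ∀ i j, parentAdj par i j = true → τ i ≠ i →
    if τ j = j then within par 2 j (τ i) = true
    else parentAdj par (τ i) (τ j) = false ∧ within par 6 (τ i) (τ j) = true

instance {m : ℕ} (par : Fin m → Fin m) (τ : Equiv.Perm (Fin m)) : Decidable (IsModel par τ) := by
  unfold IsModel; infer_instance

theorem parentAdj_comm {m : ℕ} (par : Fin m → Fin m) (i j : Fin m) :
    parentAdj par i j = parentAdj par j i := by
  simp only [parentAdj, eq_comm (a := i), Bool.or_comm]

theorem edist_le_of_within {T : SimpleGraph V} {m : ℕ} {par : Fin m → Fin m} {e : Fin m → V}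
    (he : ∀ i j, parentAdj par i j = true → T.Adj (e i) (e j)) (k : ℕ) :
    ∀ i j, within par k i j = true → T.edist (e i) (e j) ≤ k := by
  induction k with
  | zero => intro i j h; simp [within] at h; simp [h]
  | succ k ih =>
    intro i j h
    simp only [within, Bool.or_eq_true, decide_eq_true_eq] at h
    rcases h with rfl | ⟨l, h1, h2⟩
    · simp
    · refine SimpleGraph.edist_triangle.trans ((add_le_add
        (SimpleGraph.edist_eq_one_iff_adj.2 (he i l h1)).le (ih l j h2)).trans ?_)
      push_cast
      rw [add_comm]

/-- The vertices moved by `τ` have all their neighbours in `A` inside the copy, so the copy meets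
the rest of `A` only at the fixed point of `τ`. That point stays in the smaller set and is moved by
`σ`; its other neighbours are unrestricted. Hence only the edges at this point mix the two
permutations. If `τ` has no fixed point, there are no such edges. -/
theorem HasShortPlacement.of_model {T : SimpleGraph V} {A : Set V} {m : ℕ} {par : Fin m → Fin m}
    {τ : Equiv.Perm (Fin m)} (hm : IsModel par τ) (e : Fin m ↪ V) (heA : ∀ i, e i ∈ A)
    (hadj : ∀ i, τ i ≠ i → ∀ u ∈ A, T.Adj (e i) u ↔ ∃ j, parentAdj par i j = true ∧ u = e j)
    (h : HasShortPlacement T (A \ e '' {i | τ i ≠ i})) : HasShortPlacement T A := by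
  obtain ⟨huniq, h4, h5, hE⟩ := hm
  obtain ⟨σ, hfix, hmove, hedge⟩ := h
  have hadj' : ∀ i j, τ i ≠ i → (T.Adj (e i) (e j) ↔ parentAdj par i j = true) := by
    intro i j hi
    rw [hadj i hi _ (heA j)]
    constructor
    · rintro ⟨l, hl, hlj⟩
      rwa [e.injective hlj]
    · exact fun h => ⟨j, h, rfl⟩
  have hT : ∀ i j, parentAdj par i j = true → T.Adj (e i) (e j) := by
    intro i j hij
    by_cases hi : τ i = i
    · by_cases hj : τ j = j
      · have := huniq i j hi hj
        subst this
        simp [parentAdj] at hij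
      · rw [parentAdj_comm] at hij
        exact ((hadj' j i hj).2 hij).symm
    · exact (hadj' i j hi).2 hij
  set B : Set V := e '' {i | τ i ≠ i} with hB
  have hmv : ∀ i, τ i ≠ i → τ (τ i) ≠ τ i := fun i hi h => hi (τ.injective h)
  have hBmem : ∀ i, e i ∈ B ↔ τ i ≠ i := by
    intro i
    simp [hB]
  have hfixB : ∀ i, τ i ≠ i → σ (e i) = e i := fun i hi =>
    hfix _ fun hc => hc.2 ((hBmem i).2 hi)
  have hσA : ∀ v ∈ A \ B, σ v ∈ A \ B := by
    intro v hv
    by_contra hc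
    exact (hmove v hv).1 (σ.injective (hfix _ hc))
  -- The factors have disjoint supports: the transported `τ` moves exactly `B`, and `σ` moves
  -- exactly `A \ B`.
  set ρ : Equiv.Perm V := σ * τ.viaEmbedding e with hρ
  have hρB : ∀ i, τ i ≠ i → ρ (e i) = e (τ i) := by
    intro i hi
    simp only [hρ, Equiv.Perm.mul_apply, Equiv.Perm.viaEmbedding_apply]
    exact hfixB _ (hmv i hi)
  have hρA : ∀ v, v ∉ B → ρ v = σ v := by
    intro v hv
    simp only [hρ, Equiv.Perm.mul_apply]
    congr 1
    by_cases hr : v ∈ Set.range e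
    · obtain ⟨i, rfl⟩ := hr
      rw [Equiv.Perm.viaEmbedding_apply, not_not.1 (fun h => hv ((hBmem i).2 h))]
    · exact Equiv.Perm.viaEmbedding_apply_of_notMem _ _ _ hr
  have hcase : ∀ v ∈ A, (∃ i, τ i ≠ i ∧ e i = v) ∨ v ∈ A \ B := by
    intro v hv
    by_cases hvB : v ∈ B
    · obtain ⟨i, hi, rfl⟩ := hvB
      exact Or.inl ⟨i, hi, rfl⟩
    · exact Or.inr ⟨hv, hvB⟩
  have hmixed : ∀ i, τ i ≠ i → ∀ v ∈ A \ B, T.Adj (e i) v →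
      ¬ T.Adj (ρ (e i)) (ρ v) ∧ T.edist (ρ (e i)) (ρ v) ≤ 6 := by
    intro i hi v hv hiv
    rw [hρB i hi, hρA v hv.2]
    obtain ⟨j, hij, rfl⟩ := (hadj i hi v hv.1).1 hiv
    have hj : τ j = j := by
      by_contra hj
      exact hv.2 ((hBmem j).2 hj)
    constructor
    -- Outside `B`, the vertex `e (τ i)` can only be adjacent to the attachment vertex `e j`, so an
    -- edge would force `σ (e j) = e j`.
    · intro hc
      have hs := hσA _ hv
      obtain ⟨l, hl, hle⟩ := (hadj _ (hmv i hi) _ hs.1).1 hc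
      have hl' : τ l = l := by
        by_contra hl'
        exact hs.2 (hle ▸ (hBmem l).2 hl')
      rw [huniq l j hl' hj] at hle
      exact (hmove _ hv).1 hle
    -- Distance at most 2 from the image to the attachment vertex, plus the displacement of at most
    -- 4 of the latter.
    · have h2 := hE i j hij hi
      rw [if_pos hj] at h2
      have h2' := edist_le_of_within hT 2 _ _ h2
      rw [SimpleGraph.edist_comm] at h2'
      refine SimpleGraph.edist_triangle.trans ((add_le_add h2' (hmove _ hv).2.1).trans ?_)
      norm_num
  refine ⟨ρ, ?_, ?_, ?_⟩
  · intro v hv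
    have hvB : v ∉ B := by
      rintro ⟨i, -, rfl⟩
      exact hv (heA i)
    rw [hρA v hvB]
    exact hfix v fun hc => hv hc.1
  · intro v hv
    rcases hcase v hv with ⟨i, hi, rfl⟩ | hv'
    · rw [hρB i hi]
      refine ⟨fun hc => hi (e.injective hc), edist_le_of_within hT 4 _ _ (h4 i), ?_⟩
      obtain ⟨k, hk⟩ := h5 i
      refine ⟨k, ?_⟩
      have key : ∀ n : ℕ, ρ^[n] (e i) = e (τ^[n] i) ∧ τ (τ^[n] i) ≠ τ^[n] i := by
        intro n
        induction n with
        | zero => exact ⟨rfl, hi⟩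
        | succ n ih =>
          simp only [Function.iterate_succ_apply']
          rw [ih.1, hρB _ ih.2]
          exact ⟨rfl, hmv _ ih.2⟩
      rw [(key _).1, hk]
    · rw [hρA v hv'.2]
      obtain ⟨a, b, k, hk⟩ := hmove v hv'
      refine ⟨a, b, k, ?_⟩
      have key : ∀ n : ℕ, ρ^[n] v = σ^[n] v ∧ σ^[n] v ∈ A \ B := by
        intro n
        induction n with
        | zero => exact ⟨rfl, hv'⟩
        | succ n ih =>
          simp only [Function.iterate_succ_apply']
          rw [ih.1, hρA _ ih.2.2]
          exact ⟨rfl, hσA _ ih.2⟩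
      rw [(key _).1, hk]
  · intro u hu v hv huv
    rcases hcase u hu with ⟨i, hi, rfl⟩ | hu'
    · rcases hcase v hv with ⟨j, hj, rfl⟩ | hv'
      · rw [hρB i hi, hρB j hj]
        have h6 := hE i j ((hadj' i j hi).1 huv) hi
        rw [if_neg hj] at h6
        refine ⟨?_, edist_le_of_within hT 6 _ _ h6.2⟩
        rw [hadj' _ _ (hmv i hi), h6.1]
        simp
      · exact hmixed i hi v hv' huv
    · rcases hcase v hv with ⟨j, hj, rfl⟩ | hv'
      · rw [SimpleGraph.adj_comm, SimpleGraph.edist_comm]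
        exact hmixed j hj u hu' huv.symm
      · rw [hρA u hu'.2, hρA v hv'.2]
        exact hedge u hu' v hv' huv

variable {T : SimpleGraph V} {A : Set V}

/-! ### Explicit placements of the exceptional trees. -/

/-- In this and the other exceptional trees `τ` has no fixed point, so the copy exhausts `A` and the
empty set remains. -/
theorem HasShortPlacement.of_path_four {x a b c : V} (hA : A = {x, a, b, c})
    (hnd : [x, a, b, c].Nodup) (hx : ∀ u ∈ A, T.Adj x u ↔ u = a)
    (ha : ∀ u ∈ A, T.Adj a u ↔ u = x ∨ u = b) (hb : ∀ u ∈ A, T.Adj b u ↔ u = a ∨ u = c)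
    (hc : ∀ u ∈ A, T.Adj c u ↔ u = b) : HasShortPlacement T A := by
  refine HasShortPlacement.of_model (par := ![0, 0, 1, 2])
    (τ := ⟨![1, 3, 0, 2], ![2, 0, 3, 1], by decide, by decide⟩)
    (by decide +kernel) ⟨[x, a, b, c].get, List.nodup_iff_injective_get.1 hnd⟩ ?_ ?_ ?_
  · intro i
    rw [hA]
    fin_cases i <;> simp
  · intro i _ u hu
    fin_cases i <;> simp [Fin.exists_fin_succ, parentAdj, hx u hu, ha u hu, hb u hu, hc u hu]
  · convert hasShortPlacement_empty T
    rw [hA]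
    ext v
    simp [Fin.exists_fin_succ]
    tauto

theorem HasShortPlacement.of_path_five {x a b c d : V} (hA : A = {x, a, b, c, d})
    (hnd : [x, a, b, c, d].Nodup) (hx : ∀ u ∈ A, T.Adj x u ↔ u = a)
    (ha : ∀ u ∈ A, T.Adj a u ↔ u = x ∨ u = b) (hb : ∀ u ∈ A, T.Adj b u ↔ u = a ∨ u = c)
    (hc : ∀ u ∈ A, T.Adj c u ↔ u = b ∨ u = d) (hd : ∀ u ∈ A, T.Adj d u ↔ u = c) :
    HasShortPlacement T A := by
  refine HasShortPlacement.of_model (par := ![0, 0, 1, 2, 3])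
    (τ := ⟨![1, 3, 0, 4, 2], ![2, 0, 4, 1, 3], by decide, by decide⟩)
    (by decide +kernel) ⟨[x, a, b, c, d].get, List.nodup_iff_injective_get.1 hnd⟩ ?_ ?_ ?_
  · intro i
    rw [hA]
    fin_cases i <;> simp
  · intro i _ u hu
    fin_cases i <;> simp [Fin.exists_fin_succ, parentAdj, hx u hu, ha u hu, hb u hu, hc u hu,
    hd u hu]
  · convert hasShortPlacement_empty T
    rw [hA]
    ext v
    simp [Fin.exists_fin_succ]
    tauto

theorem HasShortPlacement.of_path_six {x a b c d e : V} (hA : A = {x, a, b, c, d, e})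
    (hnd : [x, a, b, c, d, e].Nodup) (hx : ∀ u ∈ A, T.Adj x u ↔ u = a)
    (ha : ∀ u ∈ A, T.Adj a u ↔ u = x ∨ u = b) (hb : ∀ u ∈ A, T.Adj b u ↔ u = a ∨ u = c)
    (hc : ∀ u ∈ A, T.Adj c u ↔ u = b ∨ u = d) (hd : ∀ u ∈ A, T.Adj d u ↔ u = c ∨ u = e)
    (he : ∀ u ∈ A, T.Adj e u ↔ u = d) : HasShortPlacement T A := by
  refine HasShortPlacement.of_model (par := ![0, 0, 1, 2, 3, 4])
    (τ := ⟨![1, 3, 5, 0, 2, 4], ![3, 0, 4, 1, 5, 2], by decide, by decide⟩)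
    (by decide +kernel) ⟨[x, a, b, c, d, e].get, List.nodup_iff_injective_get.1 hnd⟩ ?_ ?_ ?_
  · intro i
    rw [hA]
    fin_cases i <;> simp
  · intro i _ u hu
    fin_cases i <;> simp [Fin.exists_fin_succ, parentAdj, hx u hu, ha u hu, hb u hu, hc u hu,
    hd u hu, he u hu]
  · convert hasShortPlacement_empty T
    rw [hA]
    ext v
    simp [Fin.exists_fin_succ]
    tauto

theorem HasShortPlacement.of_path_seven {x a b c d e f : V} (hA : A = {x, a, b, c, d, e, f})
    (hnd : [x, a, b, c, d, e, f].Nodup) (hx : ∀ u ∈ A, T.Adj x u ↔ u = a)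
    (ha : ∀ u ∈ A, T.Adj a u ↔ u = x ∨ u = b) (hb : ∀ u ∈ A, T.Adj b u ↔ u = a ∨ u = c)
    (hc : ∀ u ∈ A, T.Adj c u ↔ u = b ∨ u = d) (hd : ∀ u ∈ A, T.Adj d u ↔ u = c ∨ u = e)
    (he : ∀ u ∈ A, T.Adj e u ↔ u = d ∨ u = f) (hf : ∀ u ∈ A, T.Adj f u ↔ u = e) :
    HasShortPlacement T A := by
  refine HasShortPlacement.of_model (par := ![0, 0, 1, 2, 3, 4, 5])
    (τ := ⟨![1, 3, 5, 0, 2, 6, 4], ![3, 0, 4, 1, 6, 2, 5], by decide, by decide⟩)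
    (by decide +kernel) ⟨[x, a, b, c, d, e, f].get, List.nodup_iff_injective_get.1 hnd⟩ ?_ ?_ ?_
  · intro i
    rw [hA]
    fin_cases i <;> simp
  · intro i _ u hu
    fin_cases i <;> simp [Fin.exists_fin_succ, parentAdj, hx u hu, ha u hu, hb u hu, hc u hu,
    hd u hu, he u hu, hf u hu]
  · convert hasShortPlacement_empty T
    rw [hA]
    ext v
    simp [Fin.exists_fin_succ]
    tauto

theorem HasShortPlacement.of_spider_two_two_one {x a b c d e : V} (hA : A = {x, a, b, c, d, e})
    (hnd : [x, a, b, c, d, e].Nodup) (hx : ∀ u ∈ A, T.Adj x u ↔ u = a ∨ u = c ∨ u = e)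
    (ha : ∀ u ∈ A, T.Adj a u ↔ u = x ∨ u = b) (hb : ∀ u ∈ A, T.Adj b u ↔ u = a)
    (hc : ∀ u ∈ A, T.Adj c u ↔ u = x ∨ u = d) (hd : ∀ u ∈ A, T.Adj d u ↔ u = c)
    (he : ∀ u ∈ A, T.Adj e u ↔ u = x) : HasShortPlacement T A := by
  refine HasShortPlacement.of_model (par := ![0, 0, 1, 0, 3, 0])
    (τ := ⟨![2, 3, 5, 4, 1, 0], ![5, 4, 0, 1, 3, 2], by decide, by decide⟩)
    (by decide +kernel) ⟨[x, a, b, c, d, e].get, List.nodup_iff_injective_get.1 hnd⟩ ?_ ?_ ?_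
  · intro i
    rw [hA]
    fin_cases i <;> simp
  · intro i _ u hu
    fin_cases i <;> simp [Fin.exists_fin_succ, parentAdj, hx u hu, ha u hu, hb u hu, hc u hu,
    hd u hu, he u hu]
  · convert hasShortPlacement_empty T
    rw [hA]
    ext v
    simp [Fin.exists_fin_succ]
    tauto

theorem HasShortPlacement.of_spider_two_two_two {x a b c d e f : V} (hA : A =
    {x, a, b, c, d, e, f}) (hnd : [x, a, b, c, d, e, f].Nodup)
    (hx : ∀ u ∈ A, T.Adj x u ↔ u = a ∨ u = c ∨ u = e) (ha : ∀ u ∈ A, T.Adj a u ↔ u = x ∨ u = b)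
    (hb : ∀ u ∈ A, T.Adj b u ↔ u = a) (hc : ∀ u ∈ A, T.Adj c u ↔ u = x ∨ u = d)
    (hd : ∀ u ∈ A, T.Adj d u ↔ u = c) (he : ∀ u ∈ A, T.Adj e u ↔ u = x ∨ u = f)
    (hf : ∀ u ∈ A, T.Adj f u ↔ u = e) : HasShortPlacement T A := by
  refine HasShortPlacement.of_model (par := ![0, 0, 1, 0, 3, 0, 5])
    (τ := ⟨![2, 3, 5, 4, 1, 6, 0], ![6, 4, 0, 1, 3, 2, 5], by decide, by decide⟩)
    (by decide +kernel) ⟨[x, a, b, c, d, e, f].get, List.nodup_iff_injective_get.1 hnd⟩ ?_ ?_ ?_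
  · intro i
    rw [hA]
    fin_cases i <;> simp
  · intro i _ u hu
    fin_cases i <;> simp [Fin.exists_fin_succ, parentAdj, hx u hu, ha u hu, hb u hu, hc u hu,
    hd u hu, he u hu, hf u hu]
  · convert hasShortPlacement_empty T
    rw [hA]
    ext v
    simp [Fin.exists_fin_succ]
    tauto

theorem HasShortPlacement.of_spider_two_one_one {x a b c d : V} (hA : A = {x, a, b, c, d})
    (hnd : [x, a, b, c, d].Nodup) (hx : ∀ u ∈ A, T.Adj x u ↔ u = a ∨ u = c ∨ u = d)
    (ha : ∀ u ∈ A, T.Adj a u ↔ u = x ∨ u = b) (hb : ∀ u ∈ A, T.Adj b u ↔ u = a)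
    (hc : ∀ u ∈ A, T.Adj c u ↔ u = x) (hd : ∀ u ∈ A, T.Adj d u ↔ u = x) : HasShortPlacement T A :=
    by
  refine HasShortPlacement.of_model (par := ![0, 0, 1, 0, 0])
    (τ := ⟨![2, 3, 1, 4, 0], ![4, 2, 0, 1, 3], by decide, by decide⟩)
    (by decide +kernel) ⟨[x, a, b, c, d].get, List.nodup_iff_injective_get.1 hnd⟩ ?_ ?_ ?_
  · intro i
    rw [hA]
    fin_cases i <;> simp
  · intro i _ u hu
    fin_cases i <;> simp [Fin.exists_fin_succ, parentAdj, hx u hu, ha u hu, hb u hu, hc u hu,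
    hd u hu]
  · convert hasShortPlacement_empty T
    rw [hA]
    ext v
    simp [Fin.exists_fin_succ]
    tauto

theorem HasShortPlacement.of_double_star_two_two {x a b c d e : V} (hA : A = {x, a, b, c, d, e})
    (hnd : [x, a, b, c, d, e].Nodup) (hx : ∀ u ∈ A, T.Adj x u ↔ u = a ∨ u = b ∨ u = c)
    (ha : ∀ u ∈ A, T.Adj a u ↔ u = x ∨ u = d ∨ u = e) (hb : ∀ u ∈ A, T.Adj b u ↔ u = x)
    (hc : ∀ u ∈ A, T.Adj c u ↔ u = x) (hd : ∀ u ∈ A, T.Adj d u ↔ u = a)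
    (he : ∀ u ∈ A, T.Adj e u ↔ u = a) : HasShortPlacement T A := by
  refine HasShortPlacement.of_model (par := ![0, 0, 0, 0, 1, 1])
    (τ := ⟨![2, 4, 1, 5, 0, 3], ![4, 2, 0, 5, 1, 3], by decide, by decide⟩)
    (by decide +kernel) ⟨[x, a, b, c, d, e].get, List.nodup_iff_injective_get.1 hnd⟩ ?_ ?_ ?_
  · intro i
    rw [hA]
    fin_cases i <;> simp
  · intro i _ u hu
    fin_cases i <;> simp [Fin.exists_fin_succ, parentAdj, hx u hu, ha u hu, hb u hu, hc u hu,
    hd u hu, he u hu]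
  · convert hasShortPlacement_empty T
    rw [hA]
    ext v
    simp [Fin.exists_fin_succ]
    tauto

/-! ### Extending a placement across deleted pendant paths. -/

/-- Here and in the other pendant lemmas, index `0` is the attachment vertex `x`, the unique fixed
point of `τ`. The names record the numbers of vertices on the deleted paths. -/
theorem HasShortPlacement.of_pendant_one_one {x a b : V} (hA : {x, a, b} ⊆ A)
    (hnd : [x, a, b].Nodup) (ha : ∀ u ∈ A, T.Adj a u ↔ u = x) (hb : ∀ u ∈ A, T.Adj b u ↔ u = x)
    (h : HasShortPlacement T (A \ {a, b})) : HasShortPlacement T A := by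
  refine HasShortPlacement.of_model (par := ![0, 0, 0])
    (τ := ⟨![0, 2, 1], ![0, 2, 1], by decide, by decide⟩)
    (by decide +kernel) ⟨[x, a, b].get, List.nodup_iff_injective_get.1 hnd⟩ ?_ ?_ ?_
  · intro i
    apply hA
    fin_cases i <;> simp
  · intro i hi u hu
    fin_cases i <;> simp [Fin.exists_fin_succ, parentAdj, ha u hu, hb u hu] at hi ⊢
  · convert h using 2
    ext v
    simp [Fin.exists_fin_succ, eq_comm (a := v)]

theorem HasShortPlacement.of_pendant_one_two {x a b c : V} (hA : {x, a, b, c} ⊆ A)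
    (hnd : [x, a, b, c].Nodup) (ha : ∀ u ∈ A, T.Adj a u ↔ u = x)
    (hb : ∀ u ∈ A, T.Adj b u ↔ u = x ∨ u = c) (hc : ∀ u ∈ A, T.Adj c u ↔ u = b)
    (h : HasShortPlacement T (A \ {a, b, c})) : HasShortPlacement T A := by
  refine HasShortPlacement.of_model (par := ![0, 0, 0, 2])
    (τ := ⟨![0, 2, 3, 1], ![0, 3, 1, 2], by decide, by decide⟩)
    (by decide +kernel) ⟨[x, a, b, c].get, List.nodup_iff_injective_get.1 hnd⟩ ?_ ?_ ?_
  · intro i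
    apply hA
    fin_cases i <;> simp
  · intro i hi u hu
    fin_cases i <;> simp [Fin.exists_fin_succ, parentAdj, ha u hu, hb u hu, hc u hu] at hi ⊢
  · convert h using 2
    ext v
    simp [Fin.exists_fin_succ, eq_comm (a := v)]

theorem HasShortPlacement.of_pendant_one_three {x a b c d : V} (hA : {x, a, b, c, d} ⊆ A)
    (hnd : [x, a, b, c, d].Nodup) (ha : ∀ u ∈ A, T.Adj a u ↔ u = x)
    (hb : ∀ u ∈ A, T.Adj b u ↔ u = x ∨ u = c) (hc : ∀ u ∈ A, T.Adj c u ↔ u = b ∨ u = d)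
    (hd : ∀ u ∈ A, T.Adj d u ↔ u = c) (h : HasShortPlacement T (A \ {a, b, c, d})) :
    HasShortPlacement T A := by
  refine HasShortPlacement.of_model (par := ![0, 0, 0, 2, 3])
    (τ := ⟨![0, 3, 1, 4, 2], ![0, 2, 4, 1, 3], by decide, by decide⟩)
    (by decide +kernel) ⟨[x, a, b, c, d].get, List.nodup_iff_injective_get.1 hnd⟩ ?_ ?_ ?_
  · intro i
    apply hA
    fin_cases i <;> simp
  · intro i hi u hu
    fin_cases i <;> simp [Fin.exists_fin_succ, parentAdj, ha u hu, hb u hu, hc u hu,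
    hd u hu] at hi ⊢
  · convert h using 2
    ext v
    simp [Fin.exists_fin_succ, eq_comm (a := v)]

theorem HasShortPlacement.of_pendant_two_two {x a b c d : V} (hA : {x, a, b, c, d} ⊆ A)
    (hnd : [x, a, b, c, d].Nodup) (ha : ∀ u ∈ A, T.Adj a u ↔ u = x ∨ u = b)
    (hb : ∀ u ∈ A, T.Adj b u ↔ u = a) (hc : ∀ u ∈ A, T.Adj c u ↔ u = x ∨ u = d)
    (hd : ∀ u ∈ A, T.Adj d u ↔ u = c) (h : HasShortPlacement T (A \ {a, b, c, d})) :
    HasShortPlacement T A := by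
  refine HasShortPlacement.of_model (par := ![0, 0, 1, 0, 3])
    (τ := ⟨![0, 2, 3, 4, 1], ![0, 4, 1, 2, 3], by decide, by decide⟩)
    (by decide +kernel) ⟨[x, a, b, c, d].get, List.nodup_iff_injective_get.1 hnd⟩ ?_ ?_ ?_
  · intro i
    apply hA
    fin_cases i <;> simp
  · intro i hi u hu
    fin_cases i <;> simp [Fin.exists_fin_succ, parentAdj, ha u hu, hb u hu, hc u hu,
    hd u hu] at hi ⊢
  · convert h using 2
    ext v
    simp [Fin.exists_fin_succ, eq_comm (a := v)]

theorem HasShortPlacement.of_pendant_two_three {x a b c d e : V} (hA : {x, a, b, c, d, e} ⊆ A)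
    (hnd : [x, a, b, c, d, e].Nodup) (ha : ∀ u ∈ A, T.Adj a u ↔ u = x ∨ u = b)
    (hb : ∀ u ∈ A, T.Adj b u ↔ u = a) (hc : ∀ u ∈ A, T.Adj c u ↔ u = x ∨ u = d)
    (hd : ∀ u ∈ A, T.Adj d u ↔ u = c ∨ u = e) (he : ∀ u ∈ A, T.Adj e u ↔ u = d)
    (h : HasShortPlacement T (A \ {a, b, c, d, e})) : HasShortPlacement T A := by
  refine HasShortPlacement.of_model (par := ![0, 0, 1, 0, 3, 4])
    (τ := ⟨![0, 4, 1, 2, 5, 3], ![0, 2, 3, 5, 1, 4], by decide, by decide⟩)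
    (by decide +kernel) ⟨[x, a, b, c, d, e].get, List.nodup_iff_injective_get.1 hnd⟩ ?_ ?_ ?_
  · intro i
    apply hA
    fin_cases i <;> simp
  · intro i hi u hu
    fin_cases i <;> simp [Fin.exists_fin_succ, parentAdj, ha u hu, hb u hu, hc u hu, hd u hu,
    he u hu] at hi ⊢
  · convert h using 2
    ext v
    simp [Fin.exists_fin_succ, eq_comm (a := v)]

theorem HasShortPlacement.of_pendant_three_three {x a b c d e f : V} (hA : {x, a, b, c, d, e, f} ⊆
    A) (hnd : [x, a, b, c, d, e, f].Nodup) (ha : ∀ u ∈ A, T.Adj a u ↔ u = x ∨ u = b)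
    (hb : ∀ u ∈ A, T.Adj b u ↔ u = a ∨ u = c) (hc : ∀ u ∈ A, T.Adj c u ↔ u = b)
    (hd : ∀ u ∈ A, T.Adj d u ↔ u = x ∨ u = e) (he : ∀ u ∈ A, T.Adj e u ↔ u = d ∨ u = f)
    (hf : ∀ u ∈ A, T.Adj f u ↔ u = e) (h : HasShortPlacement T (A \ {a, b, c, d, e, f})) :
    HasShortPlacement T A := by
  refine HasShortPlacement.of_model (par := ![0, 0, 1, 2, 0, 4, 5])
    (τ := ⟨![0, 5, 3, 4, 2, 6, 1], ![0, 6, 4, 2, 3, 1, 5], by decide, by decide⟩)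
    (by decide +kernel) ⟨[x, a, b, c, d, e, f].get, List.nodup_iff_injective_get.1 hnd⟩ ?_ ?_ ?_
  · intro i
    apply hA
    fin_cases i <;> simp
  · intro i hi u hu
    fin_cases i <;> simp [Fin.exists_fin_succ, parentAdj, ha u hu, hb u hu, hc u hu, hd u hu,
    he u hu, hf u hu] at hi ⊢
  · convert h using 2
    ext v
    simp [Fin.exists_fin_succ, eq_comm (a := v)]

theorem HasShortPlacement.of_pendant_four {x a b c d : V} (hA : {x, a, b, c, d} ⊆ A)
    (hnd : [x, a, b, c, d].Nodup) (ha : ∀ u ∈ A, T.Adj a u ↔ u = x ∨ u = b)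
    (hb : ∀ u ∈ A, T.Adj b u ↔ u = a ∨ u = c) (hc : ∀ u ∈ A, T.Adj c u ↔ u = b ∨ u = d)
    (hd : ∀ u ∈ A, T.Adj d u ↔ u = c) (h : HasShortPlacement T (A \ {a, b, c, d})) :
    HasShortPlacement T A := by
  refine HasShortPlacement.of_model (par := ![0, 0, 1, 2, 3])
    (τ := ⟨![0, 2, 4, 1, 3], ![0, 3, 1, 4, 2], by decide, by decide⟩)
    (by decide +kernel) ⟨[x, a, b, c, d].get, List.nodup_iff_injective_get.1 hnd⟩ ?_ ?_ ?_
  · intro i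
    apply hA
    fin_cases i <;> simp
  · intro i hi u hu
    fin_cases i <;> simp [Fin.exists_fin_succ, parentAdj, ha u hu, hb u hu, hc u hu,
    hd u hu] at hi ⊢
  · convert h using 2
    ext v
    simp [Fin.exists_fin_succ, eq_comm (a := v)]

/-! ### Distances in trees and geodesically closed sets. -/

variable {B : Set V}

/-- Parents are unique: geodesics from `r` through `u` and through `w` are both paths from `r` to
`v`, hence they coincide. -/
theorem eq_of_adj_of_dist_eq_add_one (hT : T.IsTree) {r u v w : V} (hu : T.Adj v u)
    (hw : T.Adj v w) (hdu : T.dist r v = T.dist r u + 1) (hdw : T.dist r v = T.dist r w + 1) :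
    u = w := by
  obtain ⟨p, hp⟩ := hT.connected.exists_walk_length_eq_dist r u
  obtain ⟨q, hq⟩ := hT.connected.exists_walk_length_eq_dist r w
  have hp' : (p.concat hu.symm).IsPath :=
    SimpleGraph.Walk.isPath_of_length_eq_dist _ (by simp [hp, hdu])
  have hq' : (q.concat hw.symm).IsPath :=
    SimpleGraph.Walk.isPath_of_length_eq_dist _ (by simp [hq, hdw])
  have h := congrArg SimpleGraph.Walk.penultimate
    ((hT.existsUnique_path r v).unique hp' hq')
  simpa using h

theorem exists_adj_dist_eq_add_one (hT : T.IsTree) {r v : V} (h : v ≠ r) :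
    ∃ u, T.Adj v u ∧ T.dist r v = T.dist r u + 1 := by
  obtain ⟨p, hp⟩ := hT.connected.exists_walk_length_eq_dist v r
  cases p with
  | nil => exact absurd rfl h
  | @cons _ u _ hvu p =>
    refine ⟨u, hvu, ?_⟩
    rcases hT.dist_eq_dist_add_one_of_adj r hvu with h | h
    · exact h
    · have := T.dist_le p
      rw [SimpleGraph.Walk.length_cons] at hp
      have h1 := T.dist_comm (u := v) (v := r)
      have h2 := T.dist_comm (u := u) (v := r)
      omega

/-- A path that has begun to lead away from `s` cannot turn back, since `b` has only one neighbour
closer to `s`. -/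
theorem dist_step (hT : T.IsTree) {s a b c : V} (hab : T.Adj a b) (hbc : T.Adj b c) (hac : a ≠ c)
    (h : T.dist s b = T.dist s a + 1) : T.dist s c = T.dist s b + 1 := by
  rcases hT.dist_eq_dist_add_one_of_adj s hbc with h' | h'
  · exact absurd (eq_of_adj_of_dist_eq_add_one hT hab.symm hbc h h') hac
  · exact h'

theorem not_adj_of_common_neighbor (hT : T.IsTree) {a b c : V} (hab : T.Adj a b)
    (hac : T.Adj a c) : ¬ T.Adj b c := by
  intro h
  have h1 := hT.dist_eq_dist_add_one_of_adj a h
  rw [SimpleGraph.dist_eq_one_iff_adj.2 hab, SimpleGraph.dist_eq_one_iff_adj.2 hac] at h1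
  omega

/-- `A` contains all geodesics of the tree `T` between its vertices. -/
def GeodesicallyClosed (T : SimpleGraph V) (A : Set V) : Prop :=
  ∀ r ∈ A, ∀ v ∈ A, ∀ u, T.Adj v u → T.dist r v = T.dist r u + 1 → u ∈ A

/-- No vertex of `A` is adjacent to all the others. -/
def NonStarOn (T : SimpleGraph V) (A : Set V) : Prop :=
  ∀ c ∈ A, ∃ v ∈ A, v ≠ c ∧ ¬ T.Adj c v

/-- A part attached only at `x` can be cut off: a geodesic entering `B` would have to come back out
through `x`. -/
theorem GeodesicallyClosed.diff (hT : T.IsTree) (hA : GeodesicallyClosed T A) {x : V}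
    (hB : ∀ b ∈ B, ∀ y ∈ A, T.Adj b y → y = x ∨ y ∈ B) : GeodesicallyClosed T (A \ B) := by
  intro r hr v hv u hvu hd
  have huA := hA r hr.1 v hv.1 u hvu hd
  refine ⟨huA, fun huB => ?_⟩
  have hvx : v = x := (hB u huB v hv.1 hvu.symm).resolve_right hv.2
  -- From a vertex of `B` closer to `r` than `x`, descending towards `r` never meets `x`, so it
  -- stays in `B` and cannot reach `r`.
  have key : ∀ n : ℕ, ∀ b ∈ B, b ∈ A → T.dist r b < T.dist r x → T.dist r b = n → False := by
    intro n
    induction n using Nat.strong_induction_on with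
    | _ n ih =>
      intro b hbB hbA hlt hn
      have hbr : b ≠ r := fun h => hr.2 (h ▸ hbB)
      obtain ⟨w, hbw, hdw⟩ := exists_adj_dist_eq_add_one hT hbr
      have hwA := hA r hr.1 b hbA w hbw hdw
      rcases hB b hbB w hwA hbw with rfl | hwB
      · omega
      · exact ih _ (by omega) w hwB hwA (by omega) rfl
  exact key _ u huB huA (by rw [← hvx]; omega) rfl

theorem GeodesicallyClosed.subset_of_closed (hT : T.IsTree) (hA : GeodesicallyClosed T A) {r : V}
    (hr : r ∈ A) (hrB : r ∈ B) (hB : ∀ b ∈ B, ∀ u ∈ A, T.Adj b u → u ∈ B) : A ⊆ B := by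
  have key : ∀ n : ℕ, ∀ v ∈ A, T.dist r v = n → v ∈ B := by
    intro n
    induction n with
    | zero =>
      intro v _ h
      rwa [← (hT.connected.dist_eq_zero_iff).1 h]
    | succ n ih =>
      intro v hv h
      have hvr : v ≠ r := by
        rintro rfl
        simp at h
      obtain ⟨u, hvu, hdu⟩ := exists_adj_dist_eq_add_one hT hvr
      exact hB u (ih u (hA r hr v hv u hvu hdu) (by omega)) v hv hvu.symm
  exact fun v hv => key _ v hv rfl

/-- The ends `p` and `t` are at distance 3, whereas a vertex adjacent to all others would put them
within 2. -/
theorem nonStarOn_of_path (hT : T.IsTree) {p q s t : V} (hp : p ∈ A) (ht : t ∈ A)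
    (hpq : T.Adj p q) (hqs : T.Adj q s) (hst : T.Adj s t) (hps : p ≠ s) (hqt : q ≠ t) :
    NonStarOn T A := by
  have h1 : T.dist p q = T.dist p p + 1 := by simp [SimpleGraph.dist_eq_one_iff_adj.2 hpq]
  have h2 := dist_step hT hpq hqs hps h1
  have h3 := dist_step hT hqs hst hqt h2
  rw [SimpleGraph.dist_self] at h1
  intro c _
  by_contra! hc
  have h4 : ∀ v ∈ A, T.dist c v ≤ 1 := by
    intro v hv
    by_cases h : v = c
    · simp [h]
    · exact (SimpleGraph.dist_eq_one_iff_adj.2 (hc v hv h)).le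
  have h5 := hT.connected.dist_triangle (u := p) (v := c) (w := t)
  have h6 := h4 p hp
  rw [SimpleGraph.dist_comm] at h6
  have h7 := h4 t ht
  omega

/-! ### Legs: their structure and existence. -/

/-- `l` is a pendant path of `A` hanging at `x` and leading away from `r`. -/
def IsLeg (T : SimpleGraph V) (A : Set V) (r : V) : V → List V → Prop
  | _, [] => True
  | x, [a] => a ∈ A ∧ T.dist r a = T.dist r x + 1 ∧ ∀ u ∈ A, T.Adj a u ↔ u = x
  | x, a :: b :: l => a ∈ A ∧ T.dist r a = T.dist r x + 1 ∧
      (∀ u ∈ A, T.Adj a u ↔ u = x ∨ u = b) ∧ IsLeg T A r a (b :: l)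

theorem IsLeg.mem {r : V} : ∀ {l : List V} {x : V}, IsLeg T A r x l → ∀ u ∈ l, u ∈ A
  | [], _, _, _, h => by simp at h
  | [a], _, h, u, hu => by
    rw [List.mem_singleton.1 hu]; exact h.1
  | a :: b :: l, _, h, u, hu => by
    rcases List.mem_cons.1 hu with rfl | hu
    · exact h.1
    · exact h.2.2.2.mem u hu

theorem IsLeg.dist_head {r x a : V} {l : List V} (h : IsLeg T A r x (a :: l)) :
    T.dist r a = T.dist r x + 1 := by
  cases l <;> exact h.2.1

theorem IsLeg.adj_head {r x a : V} {l : List V} (h : IsLeg T A r x (a :: l)) (hx : x ∈ A) :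
    T.Adj a x := by
  cases l with
  | nil => exact (h.2.2 x hx).2 rfl
  | cons b l => exact (h.2.2.1 x hx).2 (Or.inl rfl)

theorem IsLeg.dist_lt {r : V} : ∀ {l : List V} {x : V}, IsLeg T A r x l →
    ∀ u ∈ l, T.dist r x < T.dist r u
  | [], _, _, _, h => by simp at h
  | [a], _, h, u, hu => by
    rw [List.mem_singleton.1 hu, h.2.1]; omega
  | a :: b :: l, _, h, u, hu => by
    have h1 := h.2.1
    rcases List.mem_cons.1 hu with rfl | hu
    · omega
    · have := h.2.2.2.dist_lt u hu
      omega

theorem IsLeg.nodup {r : V} : ∀ {l : List V} {x : V}, IsLeg T A r x l → (x :: l).Nodup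
  | [], _, _ => by simp
  | [a], x, h => by
    have := h.dist_lt
    simp only [List.mem_singleton, forall_eq] at this
    simp only [List.nodup_cons, List.mem_singleton, List.not_mem_nil, not_false_eq_true,
      List.nodup_nil, and_self, and_true]
    rintro rfl
    omega
  | a :: b :: l, x, h =>
    List.nodup_cons.2 ⟨fun hx => lt_irrefl _ (h.dist_lt x hx), h.2.2.2.nodup⟩

theorem IsLeg.closed {r : V} : ∀ {l : List V} {x : V}, IsLeg T A r x l →
    ∀ b ∈ l, ∀ y ∈ A, T.Adj b y → y = x ∨ y ∈ l
  | [], _, _, _, h => by simp at h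
  | [a], _, h, u, hu => by
    intro y hy huy
    rw [List.mem_singleton.1 hu] at huy
    exact Or.inl ((h.2.2 y hy).1 huy)
  | a :: b :: l, _, h, u, hu => by
    intro y hy huy
    rcases List.mem_cons.1 hu with rfl | hu
    · rcases (h.2.2.1 y hy).1 huy with rfl | rfl <;> simp
    · rcases h.2.2.2.closed u hu y hy huy with rfl | h' <;> simp_all

/-- From a common vertex both legs are traced back by unique parents, and they reach their heads
simultaneously because `x` and `x'` have the same depth. -/
theorem IsLeg.head_eq (hT : T.IsTree) {r : V} : ∀ {l l' : List V} {x x' a a' u : V},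
    IsLeg T A r x (a :: l) → IsLeg T A r x' (a' :: l') → T.dist r x = T.dist r x' →
    u ∈ a :: l → u ∈ a' :: l' → a = a'
  | [], l', x, x', a, a', u, h, h', hd, hu, hu' => by
    rw [List.mem_singleton.1 hu] at hu'
    rcases List.mem_cons.1 hu' with rfl | hu'
    · rfl
    · have h1 := h.dist_head
      have h2 := h'.dist_head
      cases l' with
      | nil => simp at hu'
      | cons b' l' =>
        have := h'.2.2.2.dist_lt a hu'
        omega
  | b :: l, [], x, x', a, a', u, h, h', hd, hu, hu' => by
    rw [List.mem_singleton.1 hu'] at hu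
    rcases List.mem_cons.1 hu with rfl | hu
    · rfl
    · have h1 := h.dist_head
      have h2 := h'.dist_head
      have := h.2.2.2.dist_lt a' hu
      omega
  | b :: l, b' :: l', x, x', a, a', u, h, h', hd, hu, hu' => by
    have h1 := h.dist_head
    have h2 := h'.dist_head
    rcases List.mem_cons.1 hu with rfl | hu
    · rcases List.mem_cons.1 hu' with rfl | hu'
      · rfl
      · have := h'.2.2.2.dist_lt u hu'
        omega
    · rcases List.mem_cons.1 hu' with rfl | hu'
      · have := h.2.2.2.dist_lt u hu
        omega
      · have hb := IsLeg.head_eq hT h.2.2.2 h'.2.2.2 (by omega) hu hu'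
        have h3 := h.2.2.2.adj_head h.1
        have h4 := h'.2.2.2.adj_head h'.1
        have h5 := h.2.2.2.dist_head
        have h6 := h'.2.2.2.dist_head
        subst hb
        exact eq_of_adj_of_dist_eq_add_one hT h3 h4 h5 h6

/-- Only the direction of the first edge depends on the root; `dist_step` propagates it along the
leg. -/
theorem IsLeg.reroot (hT : T.IsTree) {r s : V} : ∀ {l : List V} {x a : V}, x ∈ A →
    IsLeg T A r x (a :: l) → T.dist s a = T.dist s x + 1 → IsLeg T A s x (a :: l)
  | [], _, _, _, h, hd => ⟨h.1, hd, h.2.2⟩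
  | b :: l, x, a, hx, h, hd => by
    refine ⟨h.1, hd, h.2.2.1, h.2.2.2.reroot hT h.1 ?_⟩
    refine dist_step hT (h.adj_head hx).symm (h.2.2.2.adj_head h.1).symm ?_ hd
    rintro rfl
    have h1 := h.dist_head
    have h2 := h.2.2.2.dist_head
    omega

theorem IsLeg.adj_root_iff {x a u : V} {l : List V} (h : IsLeg T A x x (a :: l)) (hx : x ∈ A)
    (hu : u ∈ a :: l) : T.Adj x u ↔ u = a := by
  constructor
  · intro hxu
    rcases List.mem_cons.1 hu with rfl | hu
    · rfl
    · have h1 := h.dist_head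
      have h2 := SimpleGraph.dist_eq_one_iff_adj.2 hxu
      cases l with
      | nil => simp at hu
      | cons b l =>
        have := h.2.2.2.dist_lt u hu
        rw [SimpleGraph.dist_self] at h1
        omega
  · rintro rfl
    exact (h.adj_head hx).symm

/-- Every tree which is not too small has a pendant path on four vertices, or two short pendant
paths hanging at the same vertex. -/
theorem exists_legs [Finite V] (hT : T.IsTree) (r : V)
    (h4 : ¬ ∃ x ∈ A, ∃ l, l.length = 4 ∧ IsLeg T A r x l)
    (h2 : ¬ ∃ x ∈ A, ∃ a l a' l', a ≠ a' ∧ l.length ≤ 2 ∧ l'.length ≤ 2 ∧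
      IsLeg T A r x (a :: l) ∧ IsLeg T A r x (a' :: l')) :
    ∀ v ∈ A, ∀ x ∈ A, T.Adj v x → T.dist r v = T.dist r x + 1 →
      ∃ l, l.length ≤ 2 ∧ IsLeg T A r x (v :: l) := by
  -- The order runs from the vertices farthest from `r` inwards, so the children of `v` are treated
  -- before `v`.
  have wf : WellFounded fun u v : V => T.dist r v < T.dist r u :=
    @Finite.wellFounded_of_trans_of_irrefl V _ _ ⟨fun _ _ _ h h' => lt_trans h' h⟩
      ⟨fun _ => lt_irrefl _⟩
  intro v
  induction v using wf.induction with
  | _ v ih =>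
    intro hv x hx hvx hd
    have hnb : ∀ u ∈ A, T.Adj v u → u ≠ x → T.dist r u = T.dist r v + 1 := fun u _ hvu hux =>
      dist_step hT hvx.symm hvu (Ne.symm hux) hd
    by_cases hc : ∃ b ∈ A, T.Adj v b ∧ b ≠ x
    · obtain ⟨b, hb, hvb, hbx⟩ := hc
      have hdb := hnb b hb hvb hbx
      obtain ⟨l, hl, hleg⟩ := ih b (by omega) hb v hv hvb.symm hdb
      have huniq : ∀ u ∈ A, T.Adj v u → u ≠ x → u = b := by
        intro u hu hvu hux
        by_contra hub
        have hdu := hnb u hu hvu hux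
        obtain ⟨l', hl', hleg'⟩ := ih u (by omega) hu v hv hvu.symm hdu
        exact h2 ⟨v, hv, u, l', b, l, hub, hl', hl, hleg', hleg⟩
      have hleg2 : IsLeg T A r x (v :: b :: l) := by
        refine ⟨hv, hd, fun u hu => ⟨fun h => ?_, ?_⟩, hleg⟩
        · by_cases hux : u = x
          · exact Or.inl hux
          · exact Or.inr (huniq u hu h hux)
        · rintro (rfl | rfl) <;> assumption
      refine ⟨b :: l, ?_, hleg2⟩
      -- The only excess possible is a leg `v :: b :: l` with exactly four vertices, which `h4`
      -- excludes.
      by_contra hlen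
      refine h4 ⟨x, hx, _, ?_, hleg2⟩
      simp only [List.length_cons] at hlen ⊢
      omega
    · push Not at hc
      refine ⟨[], by simp, hv, hd, fun u hu => ⟨hc u hu, ?_⟩⟩
      rintro rfl
      exact hvx

theorem IsLeg.disjoint (hT : T.IsTree) {r x a a' : V} {l l' : List V}
    (h : IsLeg T A r x (a :: l)) (h' : IsLeg T A r x (a' :: l')) (hne : a ≠ a') :
    (a :: l).Disjoint (a' :: l') :=
  fun _ hu hu' => hne (h.head_eq hT h' rfl hu hu')

theorem nodup_of_two_legs (hT : T.IsTree) {r x a a' : V} {l l' : List V}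
    (h : IsLeg T A r x (a :: l)) (h' : IsLeg T A r x (a' :: l')) (hne : a ≠ a') :
    (x :: ((a :: l) ++ (a' :: l'))).Nodup := by
  have h1 := List.nodup_cons.1 h.nodup
  have h2 := List.nodup_cons.1 h'.nodup
  refine List.nodup_cons.2 ⟨?_, h1.2.append h2.2 (h.disjoint hT h' hne)⟩
  rw [List.mem_append]
  exact fun h => h.elim h1.1 h2.1

theorem nodup_of_three_legs (hT : T.IsTree) {r x a b c : V} {l₁ l₂ l₃ : List V}
    (h₁ : IsLeg T A r x (a :: l₁)) (h₂ : IsLeg T A r x (b :: l₂)) (h₃ : IsLeg T A r x (c :: l₃))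
    (hab : a ≠ b) (hac : a ≠ c) (hbc : b ≠ c) :
    (x :: ((a :: l₁) ++ ((b :: l₂) ++ (c :: l₃)))).Nodup := by
  have h := List.nodup_cons.1 (nodup_of_two_legs hT h₂ h₃ hbc)
  have h1 := List.nodup_cons.1 h₁.nodup
  refine List.nodup_cons.2 ⟨?_, h1.2.append h.2 ?_⟩
  · rw [List.mem_append]
    exact fun h' => h'.elim h1.1 h.1
  · exact List.disjoint_append_right.2 ⟨h₁.disjoint hT h₂ hab, h₁.disjoint hT h₃ hac⟩

/-! ### Deleting legs inside the induction. -/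

/-- The lists `l` and `l'` omit the heads, so each leg has one to three vertices; ordering the
lengths leaves the six pendant patterns. -/
theorem HasShortPlacement.of_two_legs_of_length_le (hT : T.IsTree) {r x a a' : V} {l l' : List V}
    (hx : x ∈ A) (h : IsLeg T A r x (a :: l)) (h' : IsLeg T A r x (a' :: l')) (hne : a ≠ a')
    (hl : l.length ≤ l'.length) (hl' : l'.length ≤ 2)
    (hP : HasShortPlacement T (A \ {u | u ∈ a :: l ∨ u ∈ a' :: l'})) : HasShortPlacement T A := by
  have hnd := nodup_of_two_legs hT h h' hne
  have hsub : ∀ u ∈ x :: ((a :: l) ++ (a' :: l')), u ∈ A := by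
    intro u hu
    simp only [List.mem_cons, List.mem_append] at hu
    have h1 := h.mem u
    have h2 := h'.mem u
    simp only [List.mem_cons] at h1 h2
    rcases hu with rfl | hu | hu
    · exact hx
    · exact h1 hu
    · exact h2 hu
  obtain rfl | ⟨b, rfl⟩ | ⟨b, c, rfl⟩ : l = [] ∨ (∃ b, l = [b]) ∨ ∃ b c, l = [b, c] := by
    rcases l with _ | ⟨b, _ | ⟨c, _ | ⟨d, l⟩⟩⟩ <;> simp at hl ⊢; omega
  all_goals
    obtain rfl | ⟨b', rfl⟩ | ⟨b', c', rfl⟩ :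
        l' = [] ∨ (∃ b, l' = [b]) ∨ ∃ b c, l' = [b, c] := by
      rcases l' with _ | ⟨b, _ | ⟨c, _ | ⟨d, l⟩⟩⟩ <;> simp at hl' ⊢
  all_goals simp only [List.length_cons, List.length_nil] at hl
  all_goals try omega
  · refine of_pendant_one_one (fun u hu => hsub u (by simpa using hu)) hnd h.2.2 h'.2.2 ?_
    convert hP using 2; ext u; simp
  · refine of_pendant_one_two (fun u hu => hsub u (by simpa using hu)) hnd h.2.2 h'.2.2.1
      h'.2.2.2.2.2 ?_
    convert hP using 2; ext u; simp
  · refine of_pendant_one_three (fun u hu => hsub u (by simpa using hu)) hnd h.2.2 h'.2.2.1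
      h'.2.2.2.2.2.1 h'.2.2.2.2.2.2.2.2 ?_
    convert hP using 2; ext u; simp
  · refine of_pendant_two_two (fun u hu => hsub u (by simpa using hu)) hnd h.2.2.1 h.2.2.2.2.2
      h'.2.2.1 h'.2.2.2.2.2 ?_
    convert hP using 2; ext u; simp [or_assoc]
  · refine of_pendant_two_three (fun u hu => hsub u (by simpa using hu)) hnd h.2.2.1 h.2.2.2.2.2
      h'.2.2.1 h'.2.2.2.2.2.1 h'.2.2.2.2.2.2.2.2 ?_
    convert hP using 2; ext u; simp [or_assoc]
  · refine of_pendant_three_three (fun u hu => hsub u (by simpa using hu)) hnd h.2.2.1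
      h.2.2.2.2.2.1 h.2.2.2.2.2.2.2.2 h'.2.2.1 h'.2.2.2.2.2.1 h'.2.2.2.2.2.2.2.2 ?_
    convert hP using 2; ext u; simp [or_assoc]

theorem HasShortPlacement.of_two_legs (hT : T.IsTree) {r x a a' : V} {l l' : List V}
    (hx : x ∈ A) (h : IsLeg T A r x (a :: l)) (h' : IsLeg T A r x (a' :: l')) (hne : a ≠ a')
    (hl : l.length ≤ 2) (hl' : l'.length ≤ 2)
    (hP : HasShortPlacement T (A \ {u | u ∈ a :: l ∨ u ∈ a' :: l'})) : HasShortPlacement T A := by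
  rcases le_total l.length l'.length with hle | hle
  · exact of_two_legs_of_length_le hT hx h h' hne hle hl' hP
  · refine of_two_legs_of_length_le hT hx h' h hne.symm hle hl ?_
    convert hP using 3
    ext u
    exact or_comm

theorem two_legs_closed {r x : V} {l l' : List V} (h : IsLeg T A r x l) (h' : IsLeg T A r x l') :
    ∀ b ∈ {u | u ∈ l ∨ u ∈ l'}, ∀ y ∈ A, T.Adj b y → y = x ∨ y ∈ {u | u ∈ l ∨ u ∈ l'} := by
  rintro b (hb | hb) y hy hby
  · exact (h.closed b hb y hy hby).imp_right Or.inl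
  · exact (h'.closed b hb y hy hby).imp_right Or.inr

/-- The conclusion of the induction hypothesis for proper subsets of `A`. -/
def SmallerPlacements (T : SimpleGraph V) (A : Set V) : Prop :=
  ∀ A' : Set V, A'.ncard < A.ncard → A'.Nonempty → GeodesicallyClosed T A' → NonStarOn T A' →
    HasShortPlacement T A'

theorem SmallerPlacements.two_legs [Finite V] (ih : SmallerPlacements T A) (hT : T.IsTree)
    (hA : GeodesicallyClosed T A) {r x a a' : V} {l l' : List V}
    (hx : x ∈ A) (h : IsLeg T A r x (a :: l)) (h' : IsLeg T A r x (a' :: l')) (hne : a ≠ a')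
    (hl : l.length ≤ 2) (hl' : l'.length ≤ 2)
    (hN : NonStarOn T (A \ {u | u ∈ a :: l ∨ u ∈ a' :: l'})) : HasShortPlacement T A := by
  refine .of_two_legs hT hx h h' hne hl hl' (ih _ ?_ ⟨x, hx, ?_⟩ ?_ hN)
  · refine Set.ncard_lt_ncard ⟨Set.sdiff_subset, fun hs => ?_⟩
    exact (hs (h.mem a (by simp))).2 (Or.inl (by simp))
  · rintro (hu | hu)
    · exact (List.nodup_cons.1 h.nodup).1 hu
    · exact (List.nodup_cons.1 h'.nodup).1 hu
  · exact hA.diff hT (two_legs_closed h h')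

theorem SmallerPlacements.leg_four [Finite V] (ih : SmallerPlacements T A) (hT : T.IsTree)
    (hA : GeodesicallyClosed T A) {r x a b c d : V}
    (hx : x ∈ A) (h : IsLeg T A r x [a, b, c, d])
    (hN : NonStarOn T (A \ {u | u ∈ [a, b, c, d]})) : HasShortPlacement T A := by
  have hnd := h.nodup
  have hmem := h.mem
  refine .of_pendant_four (x := x) (a := a) (b := b) (c := c) (d := d) ?_ hnd h.2.2.1
    h.2.2.2.2.2.1 h.2.2.2.2.2.2.2.2.1 h.2.2.2.2.2.2.2.2.2.2.2 ?_
  · intro u hu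
    rcases hu with rfl | hu
    · exact hx
    · exact hmem u (by simpa using hu)
  · have := ih (A \ {u | u ∈ [a, b, c, d]}) ?_ ⟨x, hx, (List.nodup_cons.1 hnd).1⟩
      (hA.diff (B := {u | u ∈ [a, b, c, d]}) hT h.closed) hN
    · convert this using 2; ext u; simp
    · refine Set.ncard_lt_ncard ⟨Set.sdiff_subset, fun hs => ?_⟩
      exact (hs h.1).2 (by simp)

/-! ### Trees without twin leaves. -/

/-- Any two leaves of `A` with the same neighbour are equal. -/
def NoTwins (T : SimpleGraph V) (A : Set V) : Prop :=
  ∀ x ∈ A, ∀ u ∈ A, ∀ v ∈ A, (∀ w ∈ A, T.Adj u w ↔ w = x) → (∀ w ∈ A, T.Adj v w ↔ w = x) → u = v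

/-- Apart from `x`, the non-central vertices of the remaining star are leaves of `A` at its centre
`c`, so without twins there is at most one. The remainder is therefore a path starting at `x` with
at most two further vertices. -/
theorem exists_leg_of_not_nonStarOn_diff (hT : T.IsTree) (htw : NoTwins T A) {x : V} (hx : x ∈ A)
    (hxB : x ∉ B) (hB : ∀ b ∈ B, ∀ y ∈ A, T.Adj b y → y = x ∨ y ∈ B)
    (hN : ¬ NonStarOn T (A \ B)) :
    ∃ l, l.length ≤ 2 ∧ IsLeg T A x x l ∧ A \ B = {u | u = x ∨ u ∈ l} := by
  unfold NonStarOn at hN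
  push Not at hN
  obtain ⟨c, hc, hcadj⟩ := hN
  have hleaf : ∀ v ∈ A \ B, v ≠ c → v ≠ x → ∀ w ∈ A, T.Adj v w ↔ w = c := by
    intro v hv hvc hvx w hw
    constructor
    · intro hvw
      by_contra hwc
      have hwB : w ∉ B := fun hwB => (hB w hwB v hv.1 hvw.symm).elim hvx hv.2
      exact not_adj_of_common_neighbor hT (hcadj v hv hvc) (hcadj w ⟨hw, hwB⟩ hwc) hvw
    · rintro rfl
      exact (hcadj v hv hvc).symm
  by_cases hcx : c = x
  · subst hcx
    by_cases hv : ∃ v ∈ A \ B, v ≠ c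
    · obtain ⟨v, hv, hvc⟩ := hv
      refine ⟨[v], by simp, ⟨hv.1, ?_, hleaf v hv hvc hvc⟩, ?_⟩
      · simpa using hcadj v hv hvc
      · ext u
        constructor
        · intro hu
          by_cases huc : u = c
          · exact Or.inl huc
          · exact Or.inr (List.mem_singleton.2 (htw c hx u hu.1 v hv.1 (hleaf u hu huc huc)
              (hleaf v hv hvc hvc)))
        · rintro (rfl | hu)
          · exact ⟨hx, hxB⟩
          · rwa [List.mem_singleton.1 hu]
    · push Not at hv
      refine ⟨[], by simp, trivial, ?_⟩
      ext u
      constructor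
      · exact fun hu => Or.inl (hv u hu)
      · rintro (rfl | hu)
        · exact ⟨hx, hxB⟩
        · simp at hu
  · have hcx' : T.Adj c x := hcadj x ⟨hx, hxB⟩ (Ne.symm hcx)
    have hdc : T.dist x c = T.dist x x + 1 := by simpa using hcx'.symm
    have hcnb : ∀ w ∈ A, T.Adj c w → w ∈ A \ B := fun w hw hcw =>
      ⟨hw, fun hwB => (hB w hwB c hc.1 hcw.symm).elim hcx hc.2⟩
    by_cases hv : ∃ v ∈ A \ B, v ≠ c ∧ v ≠ x
    · obtain ⟨v, hv, hvc, hvx⟩ := hv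
      have hall : ∀ u ∈ A \ B, u = x ∨ u = c ∨ u = v := by
        intro u hu
        by_cases hux : u = x
        · exact Or.inl hux
        by_cases huc : u = c
        · exact Or.inr (Or.inl huc)
        exact Or.inr (Or.inr (htw c hc.1 u hu.1 v hv.1 (hleaf u hu huc hux) (hleaf v hv hvc hvx)))
      refine ⟨[c, v], by simp, ⟨hc.1, hdc, fun u hu => ⟨fun h => ?_, ?_⟩, hv.1,
        dist_step hT hcx'.symm (hcadj v hv hvc) (Ne.symm hvx) hdc, hleaf v hv hvc hvx⟩, ?_⟩
      · rcases hall u (hcnb u hu h) with rfl | rfl | rfl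
        · exact Or.inl rfl
        · exact absurd h (T.irrefl)
        · exact Or.inr rfl
      · rintro (rfl | rfl)
        · exact hcx'
        · exact hcadj u hv hvc
      · ext u
        constructor
        · intro hu
          simpa using hall u hu
        · intro hu
          simp only [List.mem_cons, List.not_mem_nil, or_false, Set.mem_ofPred_eq] at hu
          rcases hu with rfl | rfl | rfl
          exacts [⟨hx, hxB⟩, hc, hv]
    · push Not at hv
      refine ⟨[c], by simp, ⟨hc.1, hdc, fun u hu => ⟨fun h => ?_, ?_⟩⟩, ?_⟩
      · exact hv u (hcnb u hu h) h.ne'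
      · rintro rfl
        exact hcx'
      · ext u
        constructor
        · intro hu
          by_cases huc : u = c
          · exact Or.inr (by simp [huc])
          · exact Or.inl (hv u hu huc)
        · rintro (rfl | hu)
          · exact ⟨hx, hxB⟩
          · rwa [List.mem_singleton.1 hu]

theorem adj_iff_swap {y p q : V} (h : ∀ u ∈ A, T.Adj y u ↔ u = p ∨ u = q) :
    ∀ u ∈ A, T.Adj y u ↔ u = q ∨ u = p :=
  fun u hu => (h u hu).trans or_comm

theorem adj_root_iff_of_one_leg {x a : V} {l : List V} (hx : x ∈ A)
    (h : IsLeg T A x x (a :: l)) (hA : ∀ u ∈ A, u = x ∨ u ∈ a :: l) :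
    ∀ u ∈ A, T.Adj x u ↔ u = a := by
  intro u hu
  rcases hA u hu with rfl | hu
  · have := h.dist_lt a (by simp)
    simp only [SimpleGraph.irrefl, false_iff]
    rintro rfl
    omega
  · exact h.adj_root_iff hx hu

theorem adj_root_iff_of_two_legs {x a b : V} {l l' : List V} (hx : x ∈ A)
    (h : IsLeg T A x x (a :: l)) (h' : IsLeg T A x x (b :: l'))
    (hA : ∀ u ∈ A, u = x ∨ u ∈ a :: l ∨ u ∈ b :: l') :
    ∀ u ∈ A, T.Adj x u ↔ u = a ∨ u = b := by
  intro u hu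
  constructor
  · intro hxu
    rcases hA u hu with rfl | hu | hu
    · exact absurd hxu T.irrefl
    · exact Or.inl ((h.adj_root_iff hx hu).1 hxu)
    · exact Or.inr ((h'.adj_root_iff hx hu).1 hxu)
  · rintro (rfl | rfl)
    · exact (h.adj_head hx).symm
    · exact (h'.adj_head hx).symm

theorem adj_root_iff_of_three_legs {x a b c : V} {l₁ l₂ l₃ : List V} (hx : x ∈ A)
    (h₁ : IsLeg T A x x (a :: l₁)) (h₂ : IsLeg T A x x (b :: l₂)) (h₃ : IsLeg T A x x (c :: l₃))
    (hA : ∀ u ∈ A, u = x ∨ u ∈ a :: l₁ ∨ u ∈ b :: l₂ ∨ u ∈ c :: l₃) :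
    ∀ u ∈ A, T.Adj x u ↔ u = a ∨ u = b ∨ u = c := by
  intro u hu
  constructor
  · intro hxu
    rcases hA u hu with rfl | hu | hu | hu
    · exact absurd hxu T.irrefl
    · exact Or.inl ((h₁.adj_root_iff hx hu).1 hxu)
    · exact Or.inr (Or.inl ((h₂.adj_root_iff hx hu).1 hxu))
    · exact Or.inr (Or.inr ((h₃.adj_root_iff hx hu).1 hxu))
  · rintro (rfl | rfl | rfl)
    · exact (h₁.adj_head hx).symm
    · exact (h₂.adj_head hx).symm
    · exact (h₃.adj_head hx).symm

theorem length_le_two_cases {l : List V} (h : l.length ≤ 2) :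
    l = [] ∨ (∃ b, l = [b]) ∨ ∃ b c, l = [b, c] := by
  rcases l with _ | ⟨b, _ | ⟨c, _ | ⟨d, l⟩⟩⟩ <;> simp at h ⊢

theorem mem_iff_of_diff_eq {x : V} {l : List V} (hBA : B ⊆ A)
    (h : A \ B = {u | u = x ∨ u ∈ l}) (u : V) : u ∈ A ↔ u = x ∨ u ∈ B ∨ u ∈ l := by
  have h1 : u ∈ A \ B ↔ u = x ∨ u ∈ l := by rw [h]; rfl
  have h2 := @hBA u
  rw [Set.mem_sdiff] at h1
  tauto

/-- If deleting the leg leaves a star, that star is a short leg at `x`, and `A` is a path on five,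
six or seven vertices. -/
theorem SmallerPlacements.of_leg_four [Finite V] (ih : SmallerPlacements T A) (hT : T.IsTree)
    (hA : GeodesicallyClosed T A) (htw : NoTwins T A) {r x : V} {l : List V}
    (hx : x ∈ A) (hl : l.length = 4) (h : IsLeg T A r x l) : HasShortPlacement T A := by
  obtain ⟨a, b, c, d, rfl⟩ := List.length_eq_four.1 hl
  by_cases hN : NonStarOn T (A \ {u | u ∈ [a, b, c, d]})
  · exact ih.leg_four hT hA hx h hN
  obtain ⟨l, hl2, hleg, hAB⟩ := exists_leg_of_not_nonStarOn_diff
    (B := {u | u ∈ [a, b, c, d]}) hT htw hx (List.nodup_cons.1 h.nodup).1 h.closed hN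
  -- Rooting at `x` puts this leg and the remaining one on the same footing, so that they can be
  -- compared.
  have h0 := h.reroot hT (s := x) hx (by simpa using (h.adj_head hx).symm)
  have hm := mem_iff_of_diff_eq (B := {u | u ∈ [a, b, c, d]}) (fun u hu => h.mem u hu) hAB
  have hmem : ∀ u, u ∈ A ↔ u = x ∨ u ∈ [a, b, c, d] ∨ u ∈ l := hm
  have hne : ∀ y ∈ l, a ≠ y := by
    rintro y hy rfl
    have : a ∈ A \ {u | u ∈ [a, b, c, d]} := by rw [hAB]; exact Or.inr hy
    exact this.2 (by simp)
  rcases length_le_two_cases hl2 with rfl | ⟨y, rfl⟩ | ⟨y, z, rfl⟩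
  · refine .of_path_five (x := x) (a := a) (b := b) (c := c) (d := d) ?_ h0.nodup
      (adj_root_iff_of_one_leg hx h0 fun u hu => by simpa using (hmem u).1 hu) h0.2.2.1
      h0.2.2.2.2.2.1 h0.2.2.2.2.2.2.2.2.1 h0.2.2.2.2.2.2.2.2.2.2.2
    ext u
    simp [hmem]
  · have hnd := nodup_of_two_legs hT hleg h0 (hne y (by simp)).symm
    refine .of_path_six (x := y) (a := x) (b := a) (c := b) (d := c) (e := d) ?_ ?_ hleg.2.2
      (adj_root_iff_of_two_legs hx hleg h0
        fun u hu => by rw [or_comm (b := u ∈ [a, b, c, d])]; exact (hmem u).1 hu) h0.2.2.1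
      h0.2.2.2.2.2.1 h0.2.2.2.2.2.2.2.2.1 h0.2.2.2.2.2.2.2.2.2.2.2
    · ext u
      simp [hmem]
      tauto
    · grind
  · have hnd := nodup_of_two_legs hT hleg h0 (hne y (by simp)).symm
    refine .of_path_seven (x := z) (a := y) (b := x) (c := a) (d := b) (e := c) (f := d) ?_ ?_
      hleg.2.2.2.2.2 (adj_iff_swap hleg.2.2.1)
      (adj_root_iff_of_two_legs hx hleg h0
        fun u hu => by rw [or_comm (b := u ∈ [a, b, c, d])]; exact (hmem u).1 hu) h0.2.2.1
      h0.2.2.2.2.2.1 h0.2.2.2.2.2.2.2.2.1 h0.2.2.2.2.2.2.2.2.2.2.2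
    · ext u
      simp [hmem]
      tauto
    · grind

/-- Here `A` is a path through `x`. Two one-vertex legs would be twins, so it has four to seven
vertices. -/
theorem HasShortPlacement.of_eq_two_legs (hT : T.IsTree) (htw : NoTwins T A) {x a a' : V}
    {l l' : List V} (hx : x ∈ A) (h : IsLeg T A x x (a :: l)) (h' : IsLeg T A x x (a' :: l'))
    (hne : a ≠ a') (hle : l.length ≤ l'.length) (hl' : l'.length ≤ 2)
    (hmem : ∀ u, u ∈ A ↔ u = x ∨ u ∈ a :: l ∨ u ∈ a' :: l') : HasShortPlacement T A := by
  have hnd := nodup_of_two_legs hT h h' hne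
  have hroot := adj_root_iff_of_two_legs hx h h' fun u hu => (hmem u).1 hu
  rcases length_le_two_cases (hle.trans hl') with rfl | ⟨b, rfl⟩ | ⟨b, c, rfl⟩ <;>
    rcases length_le_two_cases hl' with rfl | ⟨b', rfl⟩ | ⟨b', c', rfl⟩ <;>
    simp only [List.length_cons, List.length_nil] at hle <;> try omega
  · exact absurd (htw x hx a h.1 a' h'.1 h.2.2 h'.2.2) hne
  · refine .of_path_four (x := a) (a := x) (b := a') (c := b') ?_ ?_ h.2.2 hroot h'.2.2.1
      h'.2.2.2.2.2
    · ext u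
      simp [hmem]
      tauto
    · grind
  · refine .of_path_five (x := a) (a := x) (b := a') (c := b') (d := c') ?_ ?_ h.2.2 hroot h'.2.2.1
      h'.2.2.2.2.2.1 h'.2.2.2.2.2.2.2.2
    · ext u
      simp [hmem]
      tauto
    · grind
  · refine .of_path_five (x := b) (a := a) (b := x) (c := a') (d := b') ?_ ?_ h.2.2.2.2.2
      (adj_iff_swap h.2.2.1) hroot h'.2.2.1 h'.2.2.2.2.2
    · ext u
      simp [hmem]
      tauto
    · grind
  · refine .of_path_six (x := b) (a := a) (b := x) (c := a') (d := b') (e := c') ?_ ?_ h.2.2.2.2.2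
      (adj_iff_swap h.2.2.1) hroot h'.2.2.1 h'.2.2.2.2.2.1 h'.2.2.2.2.2.2.2.2
    · ext u
      simp [hmem]
      tauto
    · grind
  · refine .of_path_seven (x := c) (a := b) (b := a) (c := x) (d := a') (e := b') (f := c') ?_ ?_
      h.2.2.2.2.2.2.2.2 (adj_iff_swap h.2.2.2.2.2.1) (adj_iff_swap h.2.2.1) hroot h'.2.2.1
      h'.2.2.2.2.2.1 h'.2.2.2.2.2.2.2.2
    · ext u
      simp [hmem]
      tauto
    · grind

/-- Without twins at most one leg is a single vertex, which leaves the spiders 2,2,1 and 2,2,2. -/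
theorem HasShortPlacement.of_eq_three_short_legs (hT : T.IsTree) (htw : NoTwins T A)
    {x a a' y : V} {l l' l'' : List V} (hx : x ∈ A) (h : IsLeg T A x x (a :: l))
    (h' : IsLeg T A x x (a' :: l')) (h'' : IsLeg T A x x (y :: l'')) (hne : a ≠ a') (hay : a ≠ y)
    (hay' : a' ≠ y) (hl : l.length ≤ 1) (hl' : l'.length ≤ 1) (hl'' : l''.length ≤ 1)
    (hmem : ∀ u, u ∈ A ↔ u = x ∨ u ∈ a :: l ∨ u ∈ a' :: l' ∨ u ∈ y :: l'') :
    HasShortPlacement T A := by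
  have hnd := nodup_of_three_legs hT h h' h'' hne hay hay'
  have hroot := adj_root_iff_of_three_legs hx h h' h'' fun u hu => (hmem u).1 hu
  have hcases : ∀ k : List V, k.length ≤ 1 → k = [] ∨ ∃ b, k = [b] := by
    intro k hk
    rcases k with _ | ⟨b, _ | ⟨c, k⟩⟩ <;> simp at hk ⊢
  rcases hcases l hl with rfl | ⟨b, rfl⟩ <;> rcases hcases l' hl' with rfl | ⟨b', rfl⟩ <;>
    rcases hcases l'' hl'' with rfl | ⟨z, rfl⟩
  · exact absurd (htw x hx a h.1 a' h'.1 h.2.2 h'.2.2) hne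
  · exact absurd (htw x hx a h.1 a' h'.1 h.2.2 h'.2.2) hne
  · exact absurd (htw x hx a h.1 y h''.1 h.2.2 h''.2.2) hay
  · refine .of_spider_two_two_one (x := x) (a := a') (b := b') (c := y) (d := z) (e := a) ?_ ?_
      (fun u hu => (hroot u hu).trans (by tauto)) h'.2.2.1 h'.2.2.2.2.2 h''.2.2.1 h''.2.2.2.2.2
      h.2.2
    · ext u
      simp [hmem]
      tauto
    · grind
  · exact absurd (htw x hx a' h'.1 y h''.1 h'.2.2 h''.2.2) hay'
  · refine .of_spider_two_two_one (x := x) (a := a) (b := b) (c := y) (d := z) (e := a') ?_ ?_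
      (fun u hu => (hroot u hu).trans (by tauto)) h.2.2.1 h.2.2.2.2.2 h''.2.2.1 h''.2.2.2.2.2
      h'.2.2
    · ext u
      simp [hmem]
      tauto
    · grind
  · refine .of_spider_two_two_one (x := x) (a := a) (b := b) (c := a') (d := b') (e := y) ?_ ?_
      hroot h.2.2.1 h.2.2.2.2.2 h'.2.2.1 h'.2.2.2.2.2 h''.2.2
    · ext u
      simp [hmem]
      tauto
    · grind
  · refine .of_spider_two_two_two (x := x) (a := a) (b := b) (c := a') (d := b') (e := y) (f := z)
      ?_ ?_ hroot h.2.2.1 h.2.2.2.2.2 h'.2.2.1 h'.2.2.2.2.2 h''.2.2.1 h''.2.2.2.2.2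
    · ext u
      simp [hmem]
      tauto
    · grind

theorem nonStarOn_of_leg (hT : T.IsTree) {r x a b c : V} (hx : x ∈ A)
    (h : IsLeg T A r x [a, b, c]) (hxB : x ∉ B) (hcB : c ∉ B) : NonStarOn T (A \ B) := by
  have hnd := h.nodup
  have hc := h.2.2.2.2.2.2.1
  refine nonStarOn_of_path (p := x) (q := a) (s := b) (t := c) hT ⟨hx, hxB⟩ ⟨hc, hcB⟩
    (h.adj_head hx).symm (h.2.2.2.adj_head h.1).symm
    (h.2.2.2.2.2.2.adj_head h.2.2.2.1).symm ?_ ?_ <;> grind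

/-- If deleting both legs leaves a star, then `A` consists of `x`, these legs and possibly a third
leg with at most two vertices. When there is a third leg and one of the given legs has three
vertices, deleting the other two legs instead leaves a path on four vertices. -/
theorem SmallerPlacements.of_two_short_legs [Finite V] (ih : SmallerPlacements T A)
    (hT : T.IsTree) (hA : GeodesicallyClosed T A) (htw : NoTwins T A) {r x a a' : V}
    {l l' : List V} (hx : x ∈ A) (h : IsLeg T A r x (a :: l)) (h' : IsLeg T A r x (a' :: l'))
    (hne : a ≠ a') (hl : l.length ≤ 2) (hl' : l'.length ≤ 2) : HasShortPlacement T A := by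
  by_cases hN : NonStarOn T (A \ {u | u ∈ a :: l ∨ u ∈ a' :: l'})
  · exact ih.two_legs hT hA hx h h' hne hl hl' hN
  have hBx : x ∉ {u | u ∈ a :: l ∨ u ∈ a' :: l'} := fun hc =>
    hc.elim (List.nodup_cons.1 h.nodup).1 (List.nodup_cons.1 h'.nodup).1
  obtain ⟨k, hk, hleg, hAB⟩ := exists_leg_of_not_nonStarOn_diff hT htw hx hBx
    (two_legs_closed h h') hN
  replace h := h.reroot hT (s := x) hx (by simpa using (h.adj_head hx).symm)
  replace h' := h'.reroot hT (s := x) hx (by simpa using (h'.adj_head hx).symm)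
  have hm := mem_iff_of_diff_eq (fun u hu => hu.elim (h.mem u) (h'.mem u)) hAB
  have hmem : ∀ u, u ∈ A ↔ u = x ∨ (u ∈ a :: l ∨ u ∈ a' :: l') ∨ u ∈ k := hm
  cases k with
  | nil =>
    have hmem' : ∀ u, u ∈ A ↔ u = x ∨ u ∈ a :: l ∨ u ∈ a' :: l' := fun u => by
      rw [hmem]; simp
    rcases le_total l.length l'.length with hle | hle
    · exact .of_eq_two_legs hT htw hx h h' hne hle hl' hmem'
    · exact .of_eq_two_legs hT htw hx h' h hne.symm hle hl fun u => by
        rw [hmem', or_comm (b := u ∈ a' :: l')]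
  | cons y k =>
    have hk1 : k.length ≤ 1 := by simpa using hk
    have hyB : y ∈ A \ {u | u ∈ a :: l ∨ u ∈ a' :: l'} := by rw [hAB]; exact Or.inr (by simp)
    have hay : a ≠ y := by
      rintro rfl
      exact hyB.2 (Or.inl (by simp))
    have hay' : a' ≠ y := by
      rintro rfl
      exact hyB.2 (Or.inr (by simp))
    have hxnot : ∀ {z : V} {m : List V}, IsLeg T A x x (z :: m) → x ∉ z :: m := fun hz =>
      (List.nodup_cons.1 hz.nodup).1
    by_cases hl2 : l.length = 2
    · obtain ⟨b, c, rfl⟩ := List.length_eq_two.1 hl2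
      refine ih.two_legs hT hA hx h' hleg hay' hl' (by omega) (nonStarOn_of_leg hT hx h ?_ ?_)
      · exact fun hc => hc.elim (hxnot h') (hxnot hleg)
      · exact fun hc => hc.elim (h.disjoint hT h' hne (by simp)) (h.disjoint hT hleg hay (by simp))
    by_cases hl2' : l'.length = 2
    · obtain ⟨b, c, rfl⟩ := List.length_eq_two.1 hl2'
      refine ih.two_legs hT hA hx h hleg hay hl (by omega) (nonStarOn_of_leg hT hx h' ?_ ?_)
      · exact fun hc => hc.elim (hxnot h) (hxnot hleg)
      · exact fun hc => hc.elim (h'.disjoint hT h hne.symm (by simp))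
          (h'.disjoint hT hleg hay' (by simp))
    exact .of_eq_three_short_legs hT htw hx h h' hleg hne hay hay' (by omega) (by omega) hk1
      fun u => by rw [hmem, or_assoc]

/-! ### Trees with twin leaves. -/

/-- If deleting the twins leaves a star with centre `c`, then `A` is a double star: `x` carries
exactly `u` and `v`, and `c` carries the other leaves. With three or more leaves at `c`, two of them
are deleted instead; two give the explicit double star and one gives the spider 2,1,1. -/
theorem SmallerPlacements.of_twins [Finite V] (ih : SmallerPlacements T A) (hT : T.IsTree)
    (hA : GeodesicallyClosed T A) (hNA : NonStarOn T A) {x u v : V} (hx : x ∈ A) (hu : u ∈ A)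
    (hv : v ∈ A) (hun : ∀ w ∈ A, T.Adj u w ↔ w = x) (hvn : ∀ w ∈ A, T.Adj v w ↔ w = x)
    (huv : u ≠ v) : HasShortPlacement T A := by
  have hux : T.Adj u x := (hun x hx).2 rfl
  have hvx : T.Adj v x := (hvn x hx).2 rfl
  have hlegu : IsLeg T A x x [u] := ⟨hu, by simpa using hux.symm, hun⟩
  have hlegv : IsLeg T A x x [v] := ⟨hv, by simpa using hvx.symm, hvn⟩
  by_cases hN : NonStarOn T (A \ {w | w ∈ [u] ∨ w ∈ [v]})
  · exact ih.two_legs hT hA hx hlegu hlegv huv (by simp) (by simp) hN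
  have hmemB : ∀ w, w ∈ A \ {w | w ∈ [u] ∨ w ∈ [v]} ↔ w ∈ A ∧ w ≠ u ∧ w ≠ v := by
    intro w
    simp
  unfold NonStarOn at hN
  push Not at hN
  obtain ⟨c, hc, hcadj⟩ := hN
  simp only [hmemB] at hc hcadj
  -- Otherwise `x` would be adjacent to everything, the twins included, and `A` would be a star.
  have hcx : c ≠ x := by
    rintro rfl
    obtain ⟨w, hw, hwc, hcw⟩ := hNA c hx
    by_cases h1 : w = u
    · exact hcw (h1 ▸ hux.symm)
    by_cases h2 : w = v
    · exact hcw (h2 ▸ hvx.symm)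
    exact hcw (hcadj w ⟨hw, h1, h2⟩ hwc)
  have hcx' : T.Adj c x := hcadj x ⟨hx, hux.ne', hvx.ne'⟩ hcx.symm
  have hleaf : ∀ l ∈ A, l ≠ u → l ≠ v → l ≠ c → l ≠ x → ∀ w ∈ A, T.Adj l w ↔ w = c := by
    intro l hl hlu hlv hlc hlx w hw
    constructor
    · intro hlw
      by_contra hwc
      have hwu : w ≠ u := by
        rintro rfl
        exact hlx ((hun l hl).1 hlw.symm)
      have hwv : w ≠ v := by
        rintro rfl
        exact hlx ((hvn l hl).1 hlw.symm)
      exact not_adj_of_common_neighbor hT (hcadj l ⟨hl, hlu, hlv⟩ hlc)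
        (hcadj w ⟨hw, hwu, hwv⟩ hwc) hlw
    · rintro rfl
      exact (hcadj l ⟨hl, hlu, hlv⟩ hlc).symm
  obtain ⟨l, hl, hlx, hxl⟩ := hNA x hx
  have hlu : l ≠ u := by rintro rfl; exact hxl hux.symm
  have hlv : l ≠ v := by rintro rfl; exact hxl hvx.symm
  have hlc : l ≠ c := by rintro rfl; exact hxl hcx'.symm
  have hln := hleaf l hl hlu hlv hlc hlx
  have hcl : T.Adj c l := ((hln c hc.1).2 rfl).symm
  have hxnb : ∀ w ∈ A, T.Adj x w ↔ w = c ∨ w = u ∨ w = v := by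
    intro w hw
    constructor
    · intro hxw
      by_contra! h
      exact hcx ((hleaf w hw h.2.1 h.2.2 h.1 hxw.ne' x hx).1 hxw.symm).symm
    · rintro (rfl | rfl | rfl)
      exacts [hcx'.symm, hux.symm, hvx.symm]
  have hcu : ¬ T.Adj c u := fun h => hcx ((hun c hc.1).1 h.symm)
  have hcv : ¬ T.Adj c v := fun h => hcx ((hvn c hc.1).1 h.symm)
  by_cases h2 : ∃ l' ∈ A, l' ≠ u ∧ l' ≠ v ∧ l' ≠ c ∧ l' ≠ x ∧ l' ≠ l
  · obtain ⟨l', hl', hlu', hlv', hlc', hlx', hll'⟩ := h2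
    have hln' := hleaf l' hl' hlu' hlv' hlc' hlx'
    have hcl' : T.Adj c l' := ((hln' c hc.1).2 rfl).symm
    by_cases h3 : ∃ m ∈ A, m ≠ u ∧ m ≠ v ∧ m ≠ c ∧ m ≠ x ∧ m ≠ l ∧ m ≠ l'
    · obtain ⟨m, hm, hmu, hmv, hmc, hmx, hml, hml'⟩ := h3
      have hcm : T.Adj c m := ((hleaf m hm hmu hmv hmc hmx c hc.1).2 rfl).symm
      have hlegl : IsLeg T A c c [l] := ⟨hl, by simpa using hcl, hln⟩
      have hlegl' : IsLeg T A c c [l'] := ⟨hl', by simpa using hcl', hln'⟩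
      -- The third leaf `m` at `c` survives, and `u, x, c, m` is a path on four vertices.
      refine ih.two_legs hT hA hc.1 hlegl hlegl' hll'.symm (by simp) (by simp)
        (nonStarOn_of_path (p := u) (q := x) (s := c) (t := m) hT ⟨hu, ?_⟩ ⟨hm, ?_⟩ hux hcx'.symm
          hcm hc.2.1.symm hmx.symm)
      · simp [hlu.symm, hlu'.symm]
      · simp [hml, hml']
    · push Not at h3
      have hall : ∀ w ∈ A, w = x ∨ w = c ∨ w = u ∨ w = v ∨ w = l ∨ w = l' := by
        intro w hw
        have := h3 w hw
        tauto
      refine .of_double_star_two_two (x := x) (a := c) (b := u) (c := v) (d := l) (e := l') ?_ ?_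
        hxnb ?_ hun hvn hln hln'
      · ext w
        simp only [Set.mem_insert_iff, Set.mem_singleton_iff]
        refine ⟨hall w, ?_⟩
        rintro (rfl | rfl | rfl | rfl | rfl | rfl)
        exacts [hx, hc.1, hu, hv, hl, hl']
      · have := hux.ne
        have := hvx.ne
        grind
      · intro w hw
        constructor
        · intro hcw
          rcases hall w hw with rfl | rfl | rfl | rfl | rfl | rfl
          · simp
          · exact absurd hcw T.irrefl
          · exact absurd hcw hcu
          · exact absurd hcw hcv
          · simp
          · simp
        · rintro (rfl | rfl | rfl)
          exacts [hcx', hcl, hcl']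
  · push Not at h2
    have hall : ∀ w ∈ A, w = x ∨ w = c ∨ w = l ∨ w = u ∨ w = v := by
      intro w hw
      have := h2 w hw
      tauto
    refine .of_spider_two_one_one (x := x) (a := c) (b := l) (c := u) (d := v) ?_ ?_
      hxnb ?_ hln hun hvn
    · ext w
      simp only [Set.mem_insert_iff, Set.mem_singleton_iff]
      refine ⟨hall w, ?_⟩
      rintro (rfl | rfl | rfl | rfl | rfl)
      exacts [hx, hc.1, hl, hu, hv]
    · have := hux.ne
      have := hvx.ne
      grind
    · intro w hw
      constructor
      · intro hcw
        rcases hall w hw with rfl | rfl | rfl | rfl | rfl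
        · simp
        · exact absurd hcw T.irrefl
        · simp
        · exact absurd hcw hcu
        · exact absurd hcw hcv
      · rintro (rfl | rfl)
        exacts [hcx', hcl]

/-! ### The induction. -/

/-- When no reduction applies, `exists_legs` makes every neighbour of `r` the head of a short leg,
and two such heads would again be reducible. So `A` is a path starting at `r` with at most four
vertices, and with exactly four since it is not a star. -/
theorem SmallerPlacements.hasShortPlacement [Finite V] (ih : SmallerPlacements T A)
    (hT : T.IsTree) (hA : GeodesicallyClosed T A) (hne : A.Nonempty) (hNA : NonStarOn T A) :
    HasShortPlacement T A := by
  by_cases htw : NoTwins T A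
  swap
  · unfold NoTwins at htw
    push Not at htw
    obtain ⟨x, hx, u, hu, v, hv, hun, hvn, huv⟩ := htw
    exact ih.of_twins hT hA hNA hx hu hv hun hvn huv
  obtain ⟨r, hr⟩ := hne
  by_cases h4 : ∃ x ∈ A, ∃ l, l.length = 4 ∧ IsLeg T A r x l
  · obtain ⟨x, hx, l, hl, hleg⟩ := h4
    exact ih.of_leg_four hT hA htw hx hl hleg
  by_cases h2 : ∃ x ∈ A, ∃ a l a' l', a ≠ a' ∧ l.length ≤ 2 ∧ l'.length ≤ 2 ∧
      IsLeg T A r x (a :: l) ∧ IsLeg T A r x (a' :: l')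
  · obtain ⟨x, hx, a, l, a', l', hne, hl, hl', hleg, hleg'⟩ := h2
    exact ih.of_two_short_legs hT hA htw hx hleg hleg' hne hl hl'
  have key := exists_legs hT r h4 h2
  have hchild : ∀ a ∈ A, T.Adj r a → ∃ l, l.length ≤ 2 ∧ IsLeg T A r r (a :: l) :=
    fun a ha hra => key a ha r hr hra.symm (by simpa using hra)
  by_cases hc : ∃ a ∈ A, T.Adj r a
  swap
  · push Not at hc
    obtain ⟨v, hv, hvr, -⟩ := hNA r hr
    have := hA.subset_of_closed (B := {r}) hT hr rfl (by
      rintro b rfl u hu hbu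
      exact absurd hbu (hc u hu)) hv
    exact absurd this hvr
  obtain ⟨a, ha, hra⟩ := hc
  obtain ⟨l, hl, hleg⟩ := hchild a ha hra
  have huniq : ∀ u ∈ A, T.Adj r u → u = a := by
    intro u hu hru
    by_contra hua
    obtain ⟨l', hl', hleg'⟩ := hchild u hu hru
    exact h2 ⟨r, hr, u, l', a, l, hua, hl', hl, hleg', hleg⟩
  have hsub : ∀ u ∈ A, u = r ∨ u ∈ a :: l := by
    refine hA.subset_of_closed (B := {u | u = r ∨ u ∈ a :: l}) hT hr (Or.inl rfl) ?_
    rintro b (rfl | hb) u hu hbu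
    · right
      rw [huniq u hu hbu]
      simp
    · exact hleg.closed b hb u hu hbu
  have hroot : ∀ u ∈ A, T.Adj r u ↔ u = a := adj_root_iff_of_one_leg hr hleg hsub
  rcases length_le_two_cases hl with rfl | ⟨b, rfl⟩ | ⟨b, c, rfl⟩
  · obtain ⟨v, hv, hva, hav⟩ := hNA a ha
    rcases hsub v hv with rfl | hv'
    · exact absurd hra.symm hav
    · exact absurd (List.mem_singleton.1 hv') hva
  · obtain ⟨v, hv, hva, hav⟩ := hNA a ha
    rcases hsub v hv with rfl | hv'
    · exact absurd hra.symm hav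
    · simp only [List.mem_cons, List.not_mem_nil, or_false] at hv'
      rcases hv' with rfl | rfl
      · exact absurd rfl hva
      · exact absurd (hleg.2.2.2.adj_head ha).symm hav
  · refine .of_path_four (x := r) (a := a) (b := b) (c := c) ?_ hleg.nodup hroot hleg.2.2.1
      hleg.2.2.2.2.2.1 hleg.2.2.2.2.2.2.2.2
    ext u
    constructor
    · intro hu
      simpa using hsub u hu
    · intro hu
      rcases hu with rfl | hu
      · exact hr
      · exact hleg.mem u (by simpa using hu)

/-- Every tree that is not a star has a fixed-point-free packing into its sixth power with
displacement at most `4` and all cycles of length at most `5`. -/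
theorem hasShortPlacement_of_nonStarOn [Finite V] (hT : T.IsTree) :
    ∀ A : Set V, A.Nonempty → GeodesicallyClosed T A → NonStarOn T A → HasShortPlacement T A := by
  intro A
  induction hn : A.ncard using Nat.strong_induction_on generalizing A with
  | _ n ih =>
    intro hne hA hN
    have ih' : SmallerPlacements T A := fun A' hlt hne' hA' hN' =>
      ih _ (hn ▸ hlt) A' rfl hne' hA' hN'
    exact ih'.hasShortPlacement hT hA hne hN

/-! ### Removable leaves and counting labels. -/

variable {S : Set V}

theorem IsLeaf.eq_of_adj {v a b : V} (h : IsLeaf T v) (ha : T.Adj v a) (hb : T.Adj v b) :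
    a = b := by
  obtain ⟨w, hw⟩ := Set.ncard_eq_one.1 h
  have h1 : a ∈ T.neighborSet v := ha
  have h2 : b ∈ T.neighborSet v := hb
  rw [hw, Set.mem_singleton_iff] at h1 h2
  rw [h1, h2]

/-- A leaf has a single neighbour, so it is never an interior vertex of a geodesic. -/
theorem IsRemovable.geodesicallyClosed (hT : T.IsTree) (h : IsRemovable T S) :
    GeodesicallyClosed T Sᶜ := by
  intro r hr v hv u hvu hd huS
  have hur : u ≠ r := fun h' => hr (h' ▸ huS)
  obtain ⟨w, huw, hdw⟩ := exists_adj_dist_eq_add_one hT hur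
  have := (h.1 u huS).eq_of_adj hvu.symm huw
  subst this
  omega

theorem IsRemovable.nonStarOn (hT : T.IsTree) (h : IsRemovable T S) : NonStarOn T Sᶜ := by
  unfold NonStarOn
  by_contra! hc
  obtain ⟨c, hc, hadj⟩ := hc
  refine h.2.2 ⟨⟨c, hc⟩, ?_⟩
  ext ⟨x, hx⟩ ⟨y, hy⟩
  simp only [SimpleGraph.comap_adj, Function.Embedding.subtype_apply, SimpleGraph.starGraph_adj,
    Subtype.mk.injEq, ne_eq]
  constructor
  · intro hxy
    refine ⟨hxy.ne, ?_⟩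
    by_contra! hn
    exact not_adj_of_common_neighbor hT (hadj x hx hn.1) (hadj y hy hn.2) hxy
  · rintro ⟨hne, rfl | rfl⟩
    · exact hadj y hy (Ne.symm hne)
    · exact (hadj x hx hne).symm

/-- Two adjacent leaves would form the whole tree, but the complement of `S` is nonempty. -/
theorem IsRemovable.not_adj (hT : T.IsTree) (h : IsRemovable T S) {u v : V} (hu : u ∈ S)
    (hv : v ∈ S) : ¬ T.Adj u v := by
  intro huv
  obtain ⟨⟨a, ha⟩⟩ := h.2.1.connected.nonempty
  have hcl : GeodesicallyClosed T Set.univ := fun _ _ _ _ _ _ _ => Set.mem_univ _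
  have := hcl.subset_of_closed (B := {u, v}) hT (Set.mem_univ u) (by simp) (by
    rintro b (rfl | rfl) w - hbw
    · rw [(h.1 _ hu).eq_of_adj hbw huv]
      simp
    · rw [(h.1 _ hv).eq_of_adj hbw huv.symm]
      simp) (Set.mem_univ a)
  rcases this with rfl | rfl
  · exact ha hu
  · exact ha hv

theorem sameCycle_mem_range_iterate {σ : Equiv.Perm V} {u v : V} {k : ℕ}
    (hk : σ^[k + 1] v = v) (h : σ.SameCycle v u) : ∃ i < k + 1, σ^[i] v = u := by
  obtain ⟨n, rfl⟩ := h
  have hk' : (σ ^ (k + 1)) v = v := by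
    rw [← Equiv.Perm.iterate_eq_pow]
    exact hk
  have hpos : (0 : ℤ) < ((k + 1 : ℕ) : ℤ) := by positivity
  have h0 := Int.emod_nonneg n hpos.ne'
  have h1 := Int.emod_lt_of_pos n hpos
  refine ⟨(n % ((k + 1 : ℕ) : ℤ)).toNat, by omega, ?_⟩
  rw [Equiv.Perm.iterate_eq_pow, ← zpow_natCast, Int.toNat_of_nonneg h0]
  conv_rhs => rw [← Int.emod_add_mul_ediv n ((k + 1 : ℕ) : ℤ), zpow_add, zpow_mul,
    Equiv.Perm.mul_apply, zpow_natCast, Equiv.Perm.zpow_apply_eq_self_of_apply_eq_self hk']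

/-- Points of `S` are cycles by themselves and every other cycle has at most five points, so there
are at least `|S| + (n - |S|) / 5` cycles; the statement is this bound multiplied by 5. -/
theorem card_add_le_five_mul_card_cycles [Finite V] {σ : Equiv.Perm V} (hfix : ∀ v ∈ S, σ v = v)
    (hcyc : ∀ v, v ∉ S → ∃ k : Fin 5, σ^[k + 1] v = v) :
    Nat.card V + 4 * S.ncard ≤ 5 * Nat.card (Quotient (Equiv.Perm.SameCycle.setoid σ)) := by
  classical
  have := Fintype.ofFinite V
  have := Fintype.ofFinite (Quotient (Equiv.Perm.SameCycle.setoid σ))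
  let π : V → Quotient (Equiv.Perm.SameCycle.setoid σ) := fun v => Quotient.mk _ v
  have hπ : ∀ {u v}, π u = π v → σ.SameCycle u v := fun h => Quotient.exact h
  have heq : ∀ {u v}, u ∈ S → π u = π v → u = v := by
    intro u v hu h
    obtain ⟨n, rfl⟩ := hπ h
    exact (Equiv.Perm.zpow_apply_eq_self_of_apply_eq_self (hfix u hu) n).symm
  have hS : (S.toFinset.image π).card = S.toFinset.card := by
    refine Finset.card_image_of_injOn fun u hu v _ h => heq (by simpa using hu) h
  have hA : Sᶜ.toFinset.card ≤ 5 * (Sᶜ.toFinset.image π).card := by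
    refine Finset.card_le_mul_card_image _ _ fun a ha => ?_
    obtain ⟨v, hv, rfl⟩ := Finset.mem_image.1 ha
    obtain ⟨k, hk⟩ := hcyc v (by simpa using hv)
    calc _ ≤ ((Finset.range (k + 1)).image fun i => σ^[i] v).card := by
          refine Finset.card_le_card fun u hu => ?_
          obtain ⟨i, hi, rfl⟩ := sameCycle_mem_range_iterate hk (hπ (Finset.mem_filter.1 hu).2).symm
          exact Finset.mem_image.2 ⟨i, Finset.mem_range.2 hi, rfl⟩
      _ ≤ k + 1 := Finset.card_image_le.trans (by simp)
      _ ≤ 5 := k.2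
  have hdisj : Disjoint (S.toFinset.image π) (Sᶜ.toFinset.image π) := by
    rw [Finset.disjoint_left]
    intro a ha ha'
    obtain ⟨u, hu, rfl⟩ := Finset.mem_image.1 ha
    obtain ⟨v, hv, h⟩ := Finset.mem_image.1 ha'
    have hu' : u ∈ S := by simpa using hu
    have huv := heq hu' h.symm
    subst huv
    exact absurd hu' (by simpa using hv)
  have hle : (S.toFinset.image π).card + (Sᶜ.toFinset.image π).card ≤
      Fintype.card (Quotient (Equiv.Perm.SameCycle.setoid σ)) := by
    rw [← Finset.card_union_of_disjoint hdisj]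
    exact Finset.card_le_univ _
  have hV : S.toFinset.card + Sᶜ.toFinset.card = Nat.card V := by
    rw [← Set.ncard_eq_toFinset_card', ← Set.ncard_eq_toFinset_card', Set.ncard_add_ncard_compl]
  rw [Nat.card_eq_fintype_card (α := Quotient _), Set.ncard_eq_toFinset_card']
  omega

theorem IsRemovable.card_add_le [Finite V] (hT : T.IsTree) (h : IsRemovable T S) :
    Nat.card V + 4 * S.ncard ≤ 5 * labeledPowerNumber T 6 := by
  obtain ⟨⟨a, ha⟩⟩ := h.2.1.connected.nonempty
  obtain ⟨σ, hfix, hmove, hedge⟩ := hasShortPlacement_of_nonStarOn hT Sᶜ ⟨a, ha⟩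
    (h.geodesicallyClosed hT) (h.nonStarOn hT)
  have hfixS : ∀ v ∈ S, σ v = v := fun v hv => hfix v (not_not.2 hv)
  have hmixed : ∀ u ∈ S, ∀ v ∈ Sᶜ, T.Adj u v →
      ¬ T.Adj (σ u) (σ v) ∧ T.edist (σ u) (σ v) ≤ 6 := by
    intro u hu v hv huv
    rw [hfixS u hu]
    constructor
    · intro hc
      exact (hmove v hv).1 ((h.1 u hu).eq_of_adj hc huv)
    · refine SimpleGraph.edist_triangle.trans ((add_le_add
        (SimpleGraph.edist_eq_one_iff_adj.2 huv).le (hmove v hv).2.1).trans ?_)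
      norm_num
  have hall : ∀ u v, T.Adj u v → ¬ T.Adj (σ u) (σ v) ∧ T.edist (σ u) (σ v) ≤ 6 := by
    intro u v huv
    by_cases hu : u ∈ S
    · by_cases hv : v ∈ S
      · exact absurd huv (h.not_adj hT hu hv)
      · exact hmixed u hu v hv huv
    · by_cases hv : v ∈ S
      · rw [SimpleGraph.adj_comm, SimpleGraph.edist_comm]
        exact hmixed v hv u hu huv.symm
      · exact hedge u hu v hv huv
  -- The labels are the cycles of `σ`, the finest labeling invariant under `σ`.
  let e := Finite.equivFin (Quotient (Equiv.Perm.SameCycle.setoid σ))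
  have hpack : IsLabeledPowerPacking T 6 _ fun v => e (Quotient.mk _ v) := by
    refine ⟨e.surjective.comp Quotient.mk_surjective, σ, ?_, ?_, ?_⟩
    · unfold IsTwoPlacement
      rw [SimpleGraph.disjoint_edgeSet, disjoint_iff_inf_le]
      intro x y hxy
      obtain ⟨hm, hxy⟩ := hxy
      obtain ⟨-, u, v, huv, rfl, rfl⟩ := hm
      exact (hall u v huv).1 hxy
    · intro x y hxy
      obtain ⟨-, u, v, huv, rfl, rfl⟩ := hxy
      exact ⟨fun hc => huv.ne (σ.injective hc), (hall u v huv).2⟩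
    · intro v
      have hv : σ.SameCycle v (σ v) := ⟨1, by simp⟩
      exact congrArg e (Quotient.sound (s := Equiv.Perm.SameCycle.setoid σ) hv)
  have h1 := (isGreatest_labeledPowerNumber T 6 _ _ hpack).2 ⟨_, hpack⟩
  have h2 := card_add_le_five_mul_card_cycles (σ := σ) hfixS fun v hv => (hmove v hv).2.2
  omega

end LabeledPacking

theorem corollary1p3 {V : Type*} [Finite V] (T : SimpleGraph V) (hT : T.IsTree)
    (hstar : ¬ LabeledPacking.IsStar T) :
    LabeledPacking.maxRemovableLeaves T +
        ⌈((Nat.card V : ℚ) - (LabeledPacking.maxRemovableLeaves T : ℚ)) / 5⌉₊ ≤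
      LabeledPacking.labeledPowerNumber T 6 := by
  obtain ⟨S, hS, hrem⟩ := (LabeledPacking.isGreatest_maxRemovableLeaves T hT hstar).1
  have h := hrem.card_add_le hT
  have hle : S.ncard ≤ Nat.card V := Set.ncard_le_card S
  rw [← hS]
  -- This makes the natural subtraction in the next step exact; the goal then becomes `n - m ≤ 5 *
  -- (w - m)`, equivalent to `n + 4 * m ≤ 5 * w`.
  have hm : S.ncard ≤ LabeledPacking.labeledPowerNumber T 6 := by omega
  rw [← Nat.le_sub_iff_add_le' hm, Nat.ceil_le, Nat.cast_sub hm, div_le_iff₀ (by norm_num)]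
  have h' : ((Nat.card V + 4 * S.ncard : ℕ) : ℚ) ≤
      ((5 * LabeledPacking.labeledPowerNumber T 6 : ℕ) : ℚ) := by exact_mod_cast h
  push_cast at h'
  linarith
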